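/- Let $\mathscr{B}=\{ys=xwt\}\subset\mathbb{C}^5$ be the affine binomial fourfold that locally describes the partially resolved $\mathrm{SU}(5)$ model $$\mathscr{E}:\ Y^2+\beta_5XY+\beta_3W^2Y=X^3+\beta_4WX^2+\beta_2W^3X+\beta_0W^5$$ in the chart $(X,Y,W)=(x^2w,\,x^2wy,\,xw)$, through $s=y+\beta_5+w\beta_3$ and $t=x+\beta_4+w\beta_2+w^2\beta_0$. For each ordering $(u_i,u_j,u_k)$ of $(x,w,t)$ let $\mathscr{E}_{ij}\subset\mathbb{C}^5\times\mathbb{P}^1\times\mathbb{P}^1$, with homogeneous coordinates $[\alpha_+:\sigma_+]$, $[\alpha_-:\sigma_-]$ on the two lines, be defined by $$u_i\alpha_+=\sigma_+y,\qquad u_j\alpha_-=\sigma_-s,\qquad \alpha_+\alpha_-=\sigma_+\sigma_-u_k .$$ A transformation $g$ of $\mathscr{B}$ is said to carry $\mathscr{E}_{ij}$ to $\mathscr{E}_{i'j'}$ if it lifts to an isomorphism of varieties $\mathscr{E}_{ij}\to\mathscr{E}_{i'j'}$. Two of these varieties are related by a (conifold) flop transition if they have morphisms over $\mathscr{B}$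 to a common variety $Z$ over $\mathscr{B}$ which is a union of two Zariski-open subsets: one over which both morphisms are isomorphisms, and one over which the diagram is isomorphic to the product of an affine line with the diagram of the two small resolutions of the conifold $u_1u_2=v_1v_2$ (namely $u_1\alpha=\sigma v_1,\ v_2\alpha=\sigma u_2$ and $u_1\alpha=\sigma v_2,\ v_1\alpha=\sigma u_2$). Then: 1. The six varieties $\mathscr{E}_{ij}$ are small resolutions of $\mathscr{B}$, pairwise non-isomorphic over $\mathscr{B}$. 2. $\mathscr{E}_{ij}$ is related by a flop transition to $\mathscr{E}_{ik}$ and to $\mathscr{E}_{kj}$; any two of the six are connected by a sequence of flop transitions. 3. The symmetric group $S_3$ acts on $\mathscr{B}$ by permuting the coordinates $(x,w,t)$; a permutation $\pi$ carries $\mathscr{E}_{ij}$ to $\mathscr{E}_{\pi(i)\pi(j)}$, and the action on the six resolutions is transitive. 4. The involution $(x,w,t,y,s)\mapsto(x,w,t,-s,-y)$ of $\mathscr{B}$ carries $\mathscr{E}_{ij}$ to $\mathscr{E}_{ji}$ for all $i\neq j$. It is induced by the inverse of the group law on the smooth elliptic fibers of $\mathscr{E}$: for a point of the chart on a smooth fiber,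 there is exactly one point of the chart on the same fiber which represents its inverse, and the corresponding points of $\mathscr{B}$ are exchanged by the involution. 5. The group generated by $S_3$ and this involution has order $12$ and acts on $\mathscr{B}$ by automorphisms, each of its elements carries each of the six resolutions to exactly one of the six, and it is isomorphic to the dihedral group $\mathrm{Dih}_6$. More precisely, the six resolutions can be arranged as the vertices of a hexagon whose sides are flop transitions, in such a way that the group acts as the full symmetry group of the hexagon. -/

import Mathlib

open scoped LinearAlgebra.Projectivization

namespace FlopNetwork

noncomputable section

/-! ### Complex varieties inside products of affine spaces and projective lines -/

/-- The complex projective line. -/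
abbrev P1 : Type := ℙ ℂ (Fin 2 → ℂ)

/-- The points of the complex variety `𝔸^ι × (ℙ¹)^κ`. -/
@[ext]
structure Amb (ι κ : Type) where
  /-- the affine coordinates -/
  aff : ι → ℂ
  /-- the points of the projective lines -/
  proj : κ → P1

section Zariski

variable {ι κ ι' κ' : Type} [Fintype κ] [Fintype κ']

/-- Polynomials in the affine coordinates and in the homogeneous coordinates of the
projective lines. -/
abbrev Poly (ι κ : Type) : Type := MvPolynomial (ι ⊕ κ × Fin 2) ℂ

/-- The coordinates of a point, with a choice of representative of each projective component. -/
def Amb.coord (z : Amb ι κ) : ι ⊕ κ × Fin 2 → ℂ :=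
  Sum.elim z.aff (fun a => (z.proj a.1).rep a.2)

/-- `P` is multihomogeneous of multidegree `d` in the homogeneous coordinates of the
projective lines (there is no condition on the affine coordinates). -/
def IsMultihomogeneous (d : κ → ℕ) (P : Poly ι κ) : Prop :=
  ∀ (c : κ → ℂ) (v : ι ⊕ κ × Fin 2 → ℂ),
    MvPolynomial.eval (Sum.elim (fun i => v (Sum.inl i)) (fun a => c a.1 * v (Sum.inr a))) P
      = (∏ k, c k ^ d k) * MvPolynomial.eval v P

/-- The value of a polynomial at the chosen representative of a point. Only the vanishing of
multihomogeneous polynomials and ratios of multihomogeneous polynomials of equal multidegree are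
used below; these do not depend on the representatives. -/
def Amb.eval (z : Amb ι κ) (P : Poly ι κ) : ℂ := MvPolynomial.eval z.coord P

/-- The Zariski topology: the non-vanishing loci of multihomogeneous polynomials are a basis. -/
instance Amb.zariski : TopologicalSpace (Amb ι κ) :=
  TopologicalSpace.generateFrom
    {U | ∃ (d : κ → ℕ) (P : Poly ι κ), IsMultihomogeneous d P ∧ U = {z | z.eval P ≠ 0}}

/-- `f` is a regular function on `X`: it is Zariski-locally a ratio of multihomogeneous
polynomials of the same multidegree. -/
def IsRegularFunction (X : Set (Amb ι κ)) (f : Amb ι κ → ℂ) : Prop :=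
  ∀ z ∈ X, ∃ O : Set (Amb ι κ), IsOpen O ∧ z ∈ O ∧
    ∃ (d : κ → ℕ) (P Q : Poly ι κ), IsMultihomogeneous d P ∧ IsMultihomogeneous d Q ∧
      ∀ z' ∈ X ∩ O, z'.eval Q ≠ 0 ∧ f z' = z'.eval P / z'.eval Q

/-- `f` is a regular map from `X` to the projective line: it is Zariski-locally of the form
`[P₀ : P₁]` with multihomogeneous polynomials of the same multidegree and without common zero. -/
def IsRegularToP1 (X : Set (Amb ι κ)) (f : Amb ι κ → P1) : Prop :=
  ∀ z ∈ X, ∃ O : Set (Amb ι κ), IsOpen O ∧ z ∈ O ∧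
    ∃ (d : κ → ℕ) (P : Fin 2 → Poly ι κ), (∀ e, IsMultihomogeneous d (P e)) ∧
      ∀ z' ∈ X ∩ O, ∃ h : (fun e => z'.eval (P e)) ≠ 0,
        f z' = Projectivization.mk ℂ (fun e => z'.eval (P e)) h

/-- `f` is a regular map from `X` to `Y`; its values outside `X` are irrelevant. -/
def IsRegularMap (f : Amb ι κ → Amb ι' κ') (X : Set (Amb ι κ)) (Y : Set (Amb ι' κ')) : Prop :=
  Set.MapsTo f X Y ∧
  (∀ i, IsRegularFunction X (fun z => (f z).aff i)) ∧
  (∀ k, IsRegularToP1 X (fun z => (f z).proj k))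

/-- `f` is an isomorphism of varieties from `X` to `Y`. -/
def IsRegularIso (f : Amb ι κ → Amb ι' κ') (X : Set (Amb ι κ)) (Y : Set (Amb ι' κ')) : Prop :=
  IsRegularMap f X Y ∧ ∃ g : Amb ι' κ' → Amb ι κ, IsRegularMap g Y X ∧ Set.InvOn g f X Y

/-- `X` is covered by Zariski-open subsets which are isomorphic to Zariski-open subsets of `𝔸ⁿ`.
In particular `X` is then nonsingular of dimension `n`. -/
def IsLocallyAffineSpace (n : ℕ) (X : Set (Amb ι κ)) : Prop :=
  ∀ z ∈ X, ∃ O : Set (Amb ι κ), IsOpen O ∧ z ∈ O ∧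
    ∃ O' : Set (Amb (Fin n) (Fin 0)), IsOpen O' ∧
      ∃ e : Amb ι κ → Amb (Fin n) (Fin 0), IsRegularIso e (X ∩ O) O'

/-- The points of `Y` over a neighbourhood of which `f : X → Y` is an isomorphism. -/
def isoLocus (f : Amb ι κ → Amb ι' κ') (X : Set (Amb ι κ)) (Y : Set (Amb ι' κ')) :
    Set (Amb ι' κ') :=
  {y | y ∈ Y ∧ ∃ O : Set (Amb ι' κ'), IsOpen O ∧ y ∈ O ∧ IsRegularIso f (X ∩ f ⁻¹' O) (Y ∩ O)}

/-- The exceptional locus of `f : X → Y`. -/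
def exceptionalLocus (f : Amb ι κ → Amb ι' κ') (X : Set (Amb ι κ)) (Y : Set (Amb ι' κ')) :
    Set (Amb ι κ) :=
  {z | z ∈ X ∧ f z ∉ isoLocus f X Y}

/-- The subset `E` of the closed set `X` has codimension at least two: above every irreducible
closed subset of `E` there is a chain of length two of irreducible closed subsets of `X`. -/
def CodimAtLeastTwo (E X : Set (Amb ι κ)) : Prop :=
  ∀ T ⊆ E, IsClosed T → IsIrreducible T →
    ∃ T₁ T₂ : Set (Amb ι κ), IsClosed T₁ ∧ IsIrreducible T₁ ∧ IsClosed T₂ ∧ IsIrreducible T₂ ∧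
      T ⊂ T₁ ∧ T₁ ⊂ T₂ ∧ T₂ ⊆ X

end Zariski

/-! ### Small resolutions and flops over an affine variety -/

/-- Forgetting the projective components: `𝔸^ι × (ℙ¹)^κ → 𝔸^ι`. -/
def blowDown {ι κ : Type} (z : Amb ι κ) : Amb ι (Fin 0) := ⟨z.aff, Fin.elim0⟩

/-- The restriction to `X ⊆ 𝔸^ι × (ℙ¹)^κ` of the projection to `𝔸^ι` is a small resolution of
`Y ⊆ 𝔸^ι` of dimension `n`. Since `X` is Zariski closed in `𝔸^ι × (ℙ¹)^κ`, the morphism `X → Y`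
is projective. -/
structure IsSmallResolution {ι κ : Type} [Fintype κ] (n : ℕ)
    (X : Set (Amb ι κ)) (Y : Set (Amb ι (Fin 0))) : Prop where
  closed : IsClosed X
  irreducible : IsIrreducible X
  smooth : IsLocallyAffineSpace n X
  regular : IsRegularMap blowDown X Y
  surjective : Set.SurjOn blowDown X Y
  birational : Y ⊆ closure (isoLocus blowDown X Y)
  small : CodimAtLeastTwo (exceptionalLocus blowDown X Y) X

/-- The first homogeneous coordinate `α` of the `k`-th projective component `[α : σ]`. -/
def Amb.al {ι κ : Type} (z : Amb ι κ) (k : κ) : ℂ := (z.proj k).rep 0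

/-- The second homogeneous coordinate `σ` of the `k`-th projective component `[α : σ]`. -/
def Amb.si {ι κ : Type} (z : Amb ι κ) (k : κ) : ℂ := (z.proj k).rep 1

/-- The product of the conifold `u₁ u₂ = v₁ v₂` and an affine line; the coordinates are
`(u₁, u₂, v₁, v₂, l)`. -/
def conifoldLine : Set (Amb (Fin 5) (Fin 0)) :=
  {z | z.aff 0 * z.aff 1 = z.aff 2 * z.aff 3}

/-- The small resolution `u₁ α = σ v₁`, `v₂ α = σ u₂` of the conifold, times the line. -/
def conifoldRes₁ : Set (Amb (Fin 5) (Fin 1)) :=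
  {z | z.aff 0 * z.al 0 = z.si 0 * z.aff 2 ∧ z.aff 3 * z.al 0 = z.si 0 * z.aff 1}

/-- The small resolution `u₁ α = σ v₂`, `v₁ α = σ u₂` of the conifold, times the line. -/
def conifoldRes₂ : Set (Amb (Fin 5) (Fin 1)) :=
  {z | z.aff 0 * z.al 0 = z.si 0 * z.aff 3 ∧ z.aff 2 * z.al 0 = z.si 0 * z.aff 1}

/-- `X` and `X'`, over `Y ⊆ 𝔸^ι` via the projections to `𝔸^ι`, are related by a (conifold) flop
transition along a line: there are morphisms `f : X → Z` and `f' : X' → Z` over `Y` to a common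
variety `Z = (Z ∩ U) ∪ (Z ∩ V)` such that `f` and `f'` are isomorphisms over the open subset
`Z ∩ V` and such that over the open subset `Z ∩ U` the diagram `X → Z ← X'` is isomorphic to the
product of an affine line and Atiyah's diagram of the two small resolutions of the conifold. -/
def IsConifoldFlop {ι κ κ' : Type} [Fintype κ] [Fintype κ'] (Y : Set (Amb ι (Fin 0)))
    (X : Set (Amb ι κ)) (X' : Set (Amb ι κ')) : Prop :=
  ∃ (ι₀ κ₀ : Type) (_ : Fintype ι₀) (_ : Fintype κ₀) (Z : Set (Amb ι₀ κ₀))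
    (f : Amb ι κ → Amb ι₀ κ₀) (f' : Amb ι κ' → Amb ι₀ κ₀) (q : Amb ι₀ κ₀ → Amb ι (Fin 0)),
    IsRegularMap f X Z ∧ IsRegularMap f' X' Z ∧ IsRegularMap q Z Y ∧
    (∀ z ∈ X, q (f z) = blowDown z) ∧ (∀ z ∈ X', q (f' z) = blowDown z) ∧
    ∃ U V : Set (Amb ι₀ κ₀), IsOpen U ∧ IsOpen V ∧ Z ⊆ U ∪ V ∧
      IsRegularIso f (X ∩ f ⁻¹' V) (Z ∩ V) ∧
      IsRegularIso f' (X' ∩ f' ⁻¹' V) (Z ∩ V) ∧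
      ∃ (e₀ : Amb ι₀ κ₀ → Amb (Fin 5) (Fin 0)) (e : Amb ι κ → Amb (Fin 5) (Fin 1))
        (e' : Amb ι κ' → Amb (Fin 5) (Fin 1)),
        IsRegularIso e₀ (Z ∩ U) conifoldLine ∧
        IsRegularIso e (X ∩ f ⁻¹' U) conifoldRes₁ ∧
        IsRegularIso e' (X' ∩ f' ⁻¹' U) conifoldRes₂ ∧
        (∀ z ∈ X ∩ f ⁻¹' U, blowDown (e z) = e₀ (f z)) ∧
        (∀ z ∈ X' ∩ f' ⁻¹' U, blowDown (e' z) = e₀ (f' z))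

/-! ### The binomial variety and its six resolutions -/

/-- Affine coordinates of the binomial geometry: `inl 0, inl 1, inl 2` are `x, w, t`,
and `inr 0, inr 1` are `y, s`. -/
abbrev Coord : Type := Fin 3 ⊕ Fin 2

/-- The coordinates `(u₁, u₂, u₃) = (x, w, t)`. -/
def Amb.u {κ : Type} (z : Amb Coord κ) (m : Fin 3) : ℂ := z.aff (Sum.inl m)

/-- The coordinate `y`. -/
def Amb.y {κ : Type} (z : Amb Coord κ) : ℂ := z.aff (Sum.inr 0)

/-- The coordinate `s`. -/
def Amb.s {κ : Type} (z : Amb Coord κ) : ℂ := z.aff (Sum.inr 1)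

/-- The affine binomial variety `y s = x w t`. -/
def binomial : Set (Amb Coord (Fin 0)) :=
  {p | p.y * p.s = p.u 0 * p.u 1 * p.u 2}

/-- For a permutation `(i, j, k) = (τ 0, τ 1, τ 2)` of the three indices, the variety `ℰ_{ij}`
with equations `u_i α₊ = σ₊ y`, `u_j α₋ = σ₋ s`, `α₊ α₋ = σ₊ σ₋ u_k` in `𝔸⁵ × ℙ¹ × ℙ¹`. -/
def res (τ : Equiv.Perm (Fin 3)) : Set (Amb Coord (Fin 2)) :=
  {z | z.u (τ 0) * z.al 0 = z.si 0 * z.y ∧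
       z.u (τ 1) * z.al 1 = z.si 1 * z.s ∧
       z.al 0 * z.al 1 = z.si 0 * z.si 1 * z.u (τ 2)}

/-- The resolutions `ℰ_{ij}` and `ℰ_{i'j'}` are related by a flop transition over the binomial
variety. -/
def FlopRel (τ τ' : Equiv.Perm (Fin 3)) : Prop := IsConifoldFlop binomial (res τ) (res τ')

/-! ### The symmetries -/

/-- Permuting the coordinates `(x, w, t)` of a point: the coordinate `u_m` is moved to the
place `π m`. -/
def permPoint (π : Equiv.Perm (Fin 3)) (p : Amb Coord (Fin 0)) : Amb Coord (Fin 0) :=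
  ⟨Sum.elim (fun m => p.u (π⁻¹ m)) (fun k => p.aff (Sum.inr k)), p.proj⟩

/-- The map `(x, w, t, y, s) ↦ (x, w, t, -s, -y)`. -/
def invPoint (p : Amb Coord (Fin 0)) : Amb Coord (Fin 0) :=
  ⟨Sum.elim p.u ![-p.s, -p.y], p.proj⟩

theorem permPoint_mem (π : Equiv.Perm (Fin 3)) {p : Amb Coord (Fin 0)} (hp : p ∈ binomial) :
    permPoint π p ∈ binomial := by
  have h : p.y * p.s = p.u 0 * p.u 1 * p.u 2 := hp
  have e : ∏ m, p.u (π⁻¹ m) = ∏ m, p.u m := Equiv.prod_comp π⁻¹ p.u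
  rw [Fin.prod_univ_three, Fin.prod_univ_three] at e
  change p.y * p.s = p.u (π⁻¹ 0) * p.u (π⁻¹ 1) * p.u (π⁻¹ 2)
  rw [e, h]

theorem invPoint_mem {p : Amb Coord (Fin 0)} (hp : p ∈ binomial) : invPoint p ∈ binomial := by
  have h : p.y * p.s = p.u 0 * p.u 1 * p.u 2 := hp
  change -p.s * -p.y = p.u 0 * p.u 1 * p.u 2
  rw [← h]; ring

theorem permPoint_mul (π π' : Equiv.Perm (Fin 3)) (p : Amb Coord (Fin 0)) :
    permPoint (π * π') p = permPoint π (permPoint π' p) := by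
  ext i
  · rcases i with m | k
    · simp [permPoint, Amb.u, mul_inv_rev]
    · rfl
  · rfl

theorem permPoint_one (p : Amb Coord (Fin 0)) : permPoint 1 p = p := by
  ext i
  · rcases i with m | k <;> simp [permPoint, Amb.u]
  · rfl

theorem invPoint_invPoint (p : Amb Coord (Fin 0)) : invPoint (invPoint p) = p := by
  ext i
  · rcases i with m | k
    · simp [invPoint, Amb.u]
    · fin_cases k <;> simp [invPoint, Amb.y, Amb.s]
  · rfl

/-- The symmetric group `S₃` acting on the binomial variety by permuting `(x, w, t)`. -/
def permAct : Equiv.Perm (Fin 3) →* Equiv.Perm binomial :=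
  MonoidHom.toHomPerm
    { toFun := fun π p => ⟨permPoint π p.1, permPoint_mem π p.2⟩
      map_one' := by
        funext p
        exact Subtype.ext (permPoint_one p.1)
      map_mul' := fun π π' => by
        funext p
        exact Subtype.ext (permPoint_mul π π' p.1) }

/-- The involution `(x, w, t, y, s) ↦ (x, w, t, -s, -y)` of the binomial variety. -/
def ellInv : Equiv.Perm binomial :=
  Function.Involutive.toPerm (fun p => ⟨invPoint p.1, invPoint_mem p.2⟩)
    (fun p => Subtype.ext (invPoint_invPoint p.1))

/-- The group of transformations of the binomial variety generated by the permutations of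
`(x, w, t)` and the involution. -/
def symmetryGroup : Subgroup (Equiv.Perm binomial) :=
  Subgroup.closure (Set.range permAct ∪ {ellInv})

/-- The transformation `g` of the binomial variety carries the resolution `ℰ_{ij}` to
`ℰ_{i'j'}`: it lifts to an isomorphism of varieties from the first to the second. For `g = 1`
this says that the two are isomorphic as resolutions of the binomial variety. -/
def Carries (g : Equiv.Perm binomial) (τ τ' : Equiv.Perm (Fin 3)) : Prop :=
  ∃ φ : Amb Coord (Fin 2) → Amb Coord (Fin 2), IsRegularIso φ (res τ) (res τ') ∧
    ∀ z ∈ res τ, ∀ b : binomial, b.1 = blowDown z → blowDown (φ z) = (g b).1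

/-! ### The elliptic fibers of the `SU(5)` model -/

/-- The values of the sections `β₀, β₂, β₃, β₄, β₅` at a point of the base. -/
structure Beta where
  b0 : ℂ
  b2 : ℂ
  b3 : ℂ
  b4 : ℂ
  b5 : ℂ

/-- The fiber
`Y² + β₅ X Y + β₃ W² Y = X³ + β₄ W X² + β₂ W³ X + β₀ W⁵` of the `SU(5)` Weierstrass model. -/
def su5Curve (β : Beta) (W : ℂ) : WeierstrassCurve ℂ where
  a₁ := β.b5
  a₂ := β.b4 * W
  a₃ := β.b3 * W ^ 2
  a₄ := β.b2 * W ^ 3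
  a₆ := β.b0 * W ^ 5

/-- A point `(x, y, w)` of the chart, after the two blow-ups, that contains all the remaining
singularities. It is mapped to `(X, Y, W) = (x² w, x² w y, x w)` by the blow-ups. -/
@[ext]
structure ChartPoint where
  x : ℂ
  y : ℂ
  w : ℂ

/-- `t = x + β₄ + w β₂ + w² β₀`. -/
def ChartPoint.t (β : Beta) (q : ChartPoint) : ℂ := q.x + β.b4 + q.w * β.b2 + q.w ^ 2 * β.b0

/-- `s = y + β₅ + w β₃`. -/
def ChartPoint.s (β : Beta) (q : ChartPoint) : ℂ := q.y + β.b5 + q.w * β.b3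

/-- The part in the chart of the fiber of the blown-up `SU(5)` model over a base point. -/
def chartFiber (β : Beta) (W : ℂ) : Set ChartPoint :=
  {q | q.x * q.w = W ∧
    q.y ^ 2 + β.b5 * q.y + q.w * β.b3 * q.y
      = q.w * q.x ^ 2 + q.w ^ 3 * β.b0 * q.x + q.w ^ 2 * β.b2 * q.x + q.w * β.b4 * q.x}

/-- The point `(x, w, t, y, s)`. -/
def toBinomial (β : Beta) (q : ChartPoint) : Amb Coord (Fin 0) :=
  ⟨Sum.elim ![q.x, q.w, q.t β] ![q.y, q.s β], Fin.elim0⟩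

theorem toBinomial_mem {β : Beta} {W : ℂ} {q : ChartPoint} (hq : q ∈ chartFiber β W) :
    toBinomial β q ∈ binomial := by
  have h := hq.2
  change q.y * q.s β = q.x * q.w * q.t β
  simp only [ChartPoint.s, ChartPoint.t]
  linear_combination h

/-- `q` and `q'` are mapped by the blow-ups to points of the Weierstrass fiber which are inverse
to each other for the group law. -/
def AreInverse (β : Beta) (W : ℂ) (q q' : ChartPoint) : Prop :=
  ∃ (h : (su5Curve β W).toAffine.Nonsingular (q.x ^ 2 * q.w) (q.x ^ 2 * q.w * q.y))
    (h' : (su5Curve β W).toAffine.Nonsingular (q'.x ^ 2 * q'.w) (q'.x ^ 2 * q'.w * q'.y)),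
    WeierstrassCurve.Affine.Point.some _ _ h' = -WeierstrassCurve.Affine.Point.some _ _ h

end

end FlopNetwork

open FlopNetwork

/-! Write `τ = (i, j, k)`. The variety `res τ` is covered by three copies of 𝔸⁴ with a common point,
so it is smooth and irreducible. Over `y ≠ 0` and over `s ≠ 0` both projective coordinates are
determined by the base point, so the exceptional locus lies in `y = s = 0`. In each chart `y` and
`s` are monomials without a common variable. Hence every component of `y = 0` contains a point with
`s ≠ 0`, and the exceptional locus has codimension at least two
(`codimAtLeastTwo_exceptionalLocus`).

An isomorphism over the base forces `τ' = τ`: if `τ' 0 ≠ τ 0`, the equation `u_{i'} α₊ = σ₊ y` gives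
`[α₊ : σ₊]` two different limits at a suitable point of `res τ`, and likewise for `τ' 1` with the
second line (`eq_of_carries_one`).

For the flops, forgetting the second line maps ℰ_ij and ℰ_ik to the same variety `u_i α = σ y`, `α s
= σ u_j u_k`. Where `α ≠ 0` both maps are isomorphisms. Where `σ ≠ 0`, put `a = α/σ`: then `y = u_i
a` is eliminated, `u_i` is free, and `u_j u_k = s a` is the conifold with its two small resolutions.
The other flop, exchanging `i` and `k`, is the conjugate of this one by the involution.

On indices, `S₃` acts by left multiplication, the involution acts as right multiplication by `swap 0
1`, and the flops are right multiplications by `swap 1 2` and `swap 0 2`. The Cayley graph of these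
two transpositions is a hexagon. Left multiplications preserve the two kinds of sides and the
involution exchanges them, so together they give all twelve symmetries; rigidity makes the action
faithful (`dihedralHom_injective`).

On a smooth fiber, `−Y − a₁X − a₃` equals `x²w · (−s)`, so inversion replaces `y` by `−s`, and hence
`s` by `−y`. -/

namespace FlopNetwork

noncomputable section

open MvPolynomial

/-! ### Evaluation of polynomials at points -/

section Eval

variable {ι κ : Type}

@[simp] theorem Amb.eval_X_inl (z : Amb ι κ) (i : ι) : z.eval (X (Sum.inl i)) = z.aff i := by
  simp [Amb.eval, Amb.coord]

@[simp] theorem Amb.eval_X_inr (z : Amb ι κ) (k : κ) (e : Fin 2) :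
    z.eval (X (Sum.inr (k, e))) = (z.proj k).rep e := by
  simp [Amb.eval, Amb.coord]

@[simp] theorem Amb.eval_mul (z : Amb ι κ) (P Q : Poly ι κ) :
    z.eval (P * Q) = z.eval P * z.eval Q := map_mul _ _ _

@[simp] theorem Amb.eval_add (z : Amb ι κ) (P Q : Poly ι κ) :
    z.eval (P + Q) = z.eval P + z.eval Q := map_add _ _ _

@[simp] theorem Amb.eval_sub (z : Amb ι κ) (P Q : Poly ι κ) :
    z.eval (P - Q) = z.eval P - z.eval Q := map_sub _ _ _

@[simp] theorem Amb.eval_one (z : Amb ι κ) : z.eval (1 : Poly ι κ) = 1 := map_one _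

@[simp] theorem Amb.eval_C (z : Amb ι κ) (a : ℂ) : z.eval (C a : Poly ι κ) = a := by
  simp [Amb.eval]

end Eval

/-! ### Multihomogeneous polynomials and change of representatives -/

section Multihomogeneous

variable {ι κ : Type} [Fintype κ] {d d' : κ → ℕ} {P Q : Poly ι κ}

theorem IsMultihomogeneous.mul (hP : IsMultihomogeneous d P) (hQ : IsMultihomogeneous d' Q) :
    IsMultihomogeneous (d + d') (P * Q) := by
  intro c v
  rw [map_mul, map_mul, hP, hQ]
  simp only [Pi.add_apply, pow_add, Finset.prod_mul_distrib]
  ring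

theorem IsMultihomogeneous.add (hP : IsMultihomogeneous d P) (hQ : IsMultihomogeneous d Q) :
    IsMultihomogeneous d (P + Q) := by
  intro c v
  rw [map_add, map_add, hP, hQ]
  ring

theorem IsMultihomogeneous.neg (hP : IsMultihomogeneous d P) : IsMultihomogeneous d (-P) := by
  intro c v
  rw [map_neg, map_neg, hP]
  ring

theorem IsMultihomogeneous.sub (hP : IsMultihomogeneous d P) (hQ : IsMultihomogeneous d Q) :
    IsMultihomogeneous d (P - Q) := by
  rw [sub_eq_add_neg]
  exact hP.add hQ.neg

theorem isMultihomogeneous_C (a : ℂ) : IsMultihomogeneous (0 : κ → ℕ) (C a : Poly ι κ) := by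
  intro c v
  simp

theorem isMultihomogeneous_one : IsMultihomogeneous (0 : κ → ℕ) (1 : Poly ι κ) := by
  intro c v
  simp

theorem isMultihomogeneous_X_inl (i : ι) :
    IsMultihomogeneous (0 : κ → ℕ) (X (Sum.inl i) : Poly ι κ) := by
  intro c v
  simp

theorem isMultihomogeneous_X_inr [DecidableEq κ] (k : κ) (e : Fin 2) :
    IsMultihomogeneous (Pi.single k 1 : κ → ℕ) (X (Sum.inr (k, e)) : Poly ι κ) := by
  intro c v
  rw [Finset.prod_eq_single k]
  · simp
  · intro b _ hb
    simp [Pi.single_eq_of_ne hb]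
  · simp

/-- Changing the representatives of the projective components rescales the value of a
multihomogeneous polynomial by a factor that depends on the multidegree only. -/
theorem Amb.exists_eval_eq (z : Amb ι κ) (v : κ → Fin 2 → ℂ)
    (hv : ∀ k, ∃ h : v k ≠ 0, z.proj k = Projectivization.mk ℂ (v k) h) :
    ∃ c : κ → ℂ, (∀ k, c k ≠ 0) ∧ ∀ (d : κ → ℕ) (P : Poly ι κ), IsMultihomogeneous d P →
      z.eval P = (∏ k, c k ^ d k) *
        MvPolynomial.eval (Sum.elim z.aff (fun a => v a.1 a.2)) P := by
  have h : ∀ k, ∃ a : ℂ, a ≠ 0 ∧ (z.proj k).rep = a • v k := by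
    intro k
    obtain ⟨h0, h1⟩ := hv k
    obtain ⟨a, ha⟩ := Projectivization.exists_smul_eq_mk_rep ℂ (v k) h0
    exact ⟨a, a.ne_zero, by rw [h1, ← ha]; rfl⟩
  choose c hc0 hc using h
  refine ⟨c, hc0, fun d P hP => ?_⟩
  rw [← hP c]
  unfold Amb.eval Amb.coord
  congr 2
  funext j
  rcases j with i | ⟨k, e⟩
  · rfl
  · simp [hc k]

end Multihomogeneous

/-! ### Zariski topology and irreducibility -/

section Topology

variable {ι κ : Type} [Fintype κ]

theorem isOpen_eval_ne {d : κ → ℕ} {P : Poly ι κ} (hP : IsMultihomogeneous d P) :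
    IsOpen {z : Amb ι κ | z.eval P ≠ 0} :=
  TopologicalSpace.isOpen_generateFrom_of_mem ⟨d, P, hP, rfl⟩

theorem isClosed_eval_eq {d : κ → ℕ} {P Q : Poly ι κ} (hP : IsMultihomogeneous d P)
    (hQ : IsMultihomogeneous d Q) : IsClosed {z : Amb ι κ | z.eval P = z.eval Q} := by
  have h := (isOpen_eval_ne (hP.sub hQ)).isClosed_compl
  convert h using 1
  ext z
  simp [sub_eq_zero]

/-- The non-vanishing loci generate the topology by definition; they form a basis because a product
of multihomogeneous polynomials is multihomogeneous and cuts out the intersection. -/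
theorem exists_eval_ne_subset {O : Set (Amb ι κ)} (hO : IsOpen O) {z : Amb ι κ} (hz : z ∈ O) :
    ∃ (d : κ → ℕ) (P : Poly ι κ), IsMultihomogeneous d P ∧ z.eval P ≠ 0 ∧
      {z' : Amb ι κ | z'.eval P ≠ 0} ⊆ O := by
  induction hO with
  | basic s hs =>
    obtain ⟨d, P, hP, rfl⟩ := hs
    exact ⟨d, P, hP, hz, subset_rfl⟩
  | univ => exact ⟨0, 1, isMultihomogeneous_one, by simp, Set.subset_univ _⟩
  | inter s t _ _ ihs iht =>
    obtain ⟨d, P, hP, hPz, hPs⟩ := ihs hz.1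
    obtain ⟨d', Q, hQ, hQz, hQt⟩ := iht hz.2
    refine ⟨d + d', P * Q, hP.mul hQ, by simp [hPz, hQz], fun z' hz' => ?_⟩
    simp only [Set.mem_ofPred_eq, Amb.eval_mul] at hz'
    exact ⟨hPs (left_ne_zero_of_mul hz'), hQt (right_ne_zero_of_mul hz')⟩
  | sUnion S _ ih =>
    obtain ⟨s, hs, hzs⟩ := hz
    obtain ⟨d, P, hP, hPz, hPs⟩ := ih s hs hzs
    exact ⟨d, P, hP, hPz, hPs.trans (Set.subset_sUnion_of_mem hs)⟩

/-- Polynomials over ℂ form a domain, and a non-zero polynomial over an infinite field has a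
non-zero value, so two non-empty basic open sets meet. -/
theorem isIrreducible_univ_affineSpace : IsIrreducible (Set.univ : Set (Amb ι (Fin 0))) := by
  refine ⟨⟨⟨0, Fin.elim0⟩, trivial⟩, ?_⟩
  rintro U V hU hV ⟨z, -, hz⟩ ⟨z', -, hz'⟩
  obtain ⟨d, P, hP, hPz, hPU⟩ := exists_eval_ne_subset hU hz
  obtain ⟨d', Q, hQ, hQz, hQV⟩ := exists_eval_ne_subset hV hz'
  have hP0 : P ≠ 0 := by
    rintro rfl
    exact hPz (map_zero _)
  have hQ0 : Q ≠ 0 := by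
    rintro rfl
    exact hQz (map_zero _)
  obtain ⟨v, hv⟩ : ∃ v, MvPolynomial.eval v (P * Q) ≠ 0 := by
    by_contra! h
    exact mul_ne_zero hP0 hQ0 (MvPolynomial.funext fun v => by simpa using h v)
  let p : Amb ι (Fin 0) := ⟨fun i => v (Sum.inl i), Fin.elim0⟩
  have hp : p.coord = v := by
    funext j
    rcases j with i | ⟨k, e⟩
    · rfl
    · exact k.elim0
  have hpv : p.eval P * p.eval Q ≠ 0 := by
    rw [← Amb.eval_mul, Amb.eval, hp]
    exact hv
  exact ⟨p, trivial, hPU (left_ne_zero_of_mul hpv), hQV (right_ne_zero_of_mul hpv)⟩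

/-- A set which is covered by relatively open irreducible subsets that meet pairwise is
irreducible. -/
theorem isIrreducible_of_cover {T : Type*} [TopologicalSpace T] {α : Type*} [Nonempty α]
    {X : Set T} {O : α → Set T} (hO : ∀ a, IsOpen (O a)) (hX : X ⊆ ⋃ a, O a)
    (hirr : ∀ a, IsIrreducible (X ∩ O a)) (hmeet : ∀ a b, (X ∩ (O a ∩ O b)).Nonempty) :
    IsIrreducible X := by
  refine ⟨(hirr (Classical.arbitrary α)).1.mono Set.inter_subset_left, ?_⟩
  rintro U V hU hV ⟨z, hzX, hzU⟩ ⟨z', hzX', hzV⟩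
  obtain ⟨a, ha⟩ := Set.mem_iUnion.1 (hX hzX)
  obtain ⟨b, hb⟩ := Set.mem_iUnion.1 (hX hzX')
  obtain ⟨p, hpX, hpa, hpb⟩ := hmeet a b
  obtain ⟨r, ⟨hrX, -⟩, hrU, hrb⟩ := (hirr a).2 U (O b) hU (hO b) ⟨z, ⟨hzX, ha⟩, hzU⟩
    ⟨p, ⟨hpX, hpa⟩, hpb⟩
  obtain ⟨r', ⟨hrX', -⟩, h⟩ := (hirr b).2 U V hU hV ⟨r, ⟨hrX, hrb⟩, hrU⟩ ⟨z', ⟨hzX', hb⟩, hzV⟩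
  exact ⟨r', hrX', h⟩

end Topology

/-! ### Regular functions and regular maps to the projective line -/

section RegularFunctions

variable {ι κ : Type} [Fintype κ]
  {X X' : Set (Amb ι κ)} {f g : Amb ι κ → ℂ}

theorem IsRegularFunction.mono (hf : IsRegularFunction X f) (h : X' ⊆ X) :
    IsRegularFunction X' f := by
  intro z hz
  obtain ⟨O, hO, hzO, d, P, Q, hP, hQ, hPQ⟩ := hf z (h hz)
  exact ⟨O, hO, hzO, d, P, Q, hP, hQ, fun z' hz' => hPQ z' ⟨h hz'.1, hz'.2⟩⟩

theorem IsRegularFunction.congr (hf : IsRegularFunction X f) (h : Set.EqOn f g X) :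
    IsRegularFunction X g := by
  intro z hz
  obtain ⟨O, hO, hzO, d, P, Q, hP, hQ, hPQ⟩ := hf z hz
  exact ⟨O, hO, hzO, d, P, Q, hP, hQ, fun z' hz' =>
    ⟨(hPQ z' hz').1, (h hz'.1).symm.trans (hPQ z' hz').2⟩⟩

theorem isRegularFunction_of_locally
    (h : ∀ z ∈ X, ∃ O : Set (Amb ι κ), IsOpen O ∧ z ∈ O ∧ IsRegularFunction (X ∩ O) f) :
    IsRegularFunction X f := by
  intro z hz
  obtain ⟨O, hO, hzO, hf⟩ := h z hz
  obtain ⟨O', hO', hzO', d, P, Q, hP, hQ, hPQ⟩ := hf z ⟨hz, hzO⟩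
  exact ⟨O ∩ O', hO.inter hO', ⟨hzO, hzO'⟩, d, P, Q, hP, hQ, fun z' hz' =>
    hPQ z' ⟨⟨hz'.1, hz'.2.1⟩, hz'.2.2⟩⟩

theorem isRegularFunction_const (a : ℂ) : IsRegularFunction X (fun _ => a) := fun z _ =>
  ⟨Set.univ, isOpen_univ, trivial, 0, C a, 1, isMultihomogeneous_C a, isMultihomogeneous_one,
    fun z' _ => by simp⟩

theorem isRegularFunction_aff (i : ι) : IsRegularFunction X (fun z => z.aff i) := fun z _ =>
  ⟨Set.univ, isOpen_univ, trivial, 0, MvPolynomial.X (Sum.inl i), 1, isMultihomogeneous_X_inl i,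
    isMultihomogeneous_one, fun z' _ => by simp⟩

theorem isRegularFunction_rep_div (k : κ) (e e' : Fin 2)
    (h : ∀ z ∈ X, (z.proj k).rep e' ≠ 0) :
    IsRegularFunction X (fun z => (z.proj k).rep e / (z.proj k).rep e') := by
  classical
  exact fun z _ => ⟨Set.univ, isOpen_univ, trivial, Pi.single k 1, MvPolynomial.X (Sum.inr (k, e)),
    MvPolynomial.X (Sum.inr (k, e')), isMultihomogeneous_X_inr k e, isMultihomogeneous_X_inr k e',
    fun z' hz' => by simpa using h z' hz'.1⟩

theorem IsRegularFunction.mul (hf : IsRegularFunction X f) (hg : IsRegularFunction X g) :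
    IsRegularFunction X (fun z => f z * g z) := by
  intro z hz
  obtain ⟨O, hO, hzO, d, P, Q, hP, hQ, hPQ⟩ := hf z hz
  obtain ⟨O', hO', hzO', d', P', Q', hP', hQ', hPQ'⟩ := hg z hz
  refine ⟨O ∩ O', hO.inter hO', ⟨hzO, hzO'⟩, d + d', P * P', Q * Q', hP.mul hP', hQ.mul hQ',
    fun z' hz' => ?_⟩
  obtain ⟨h1, h2⟩ := hPQ z' ⟨hz'.1, hz'.2.1⟩
  obtain ⟨h1', h2'⟩ := hPQ' z' ⟨hz'.1, hz'.2.2⟩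
  exact ⟨by simp [h1, h1'], by
    simp only [h2, h2', Amb.eval_mul, div_mul_div_comm]⟩

theorem IsRegularFunction.add (hf : IsRegularFunction X f) (hg : IsRegularFunction X g) :
    IsRegularFunction X (fun z => f z + g z) := by
  intro z hz
  obtain ⟨O, hO, hzO, d, P, Q, hP, hQ, hPQ⟩ := hf z hz
  obtain ⟨O', hO', hzO', d', P', Q', hP', hQ', hPQ'⟩ := hg z hz
  refine ⟨O ∩ O', hO.inter hO', ⟨hzO, hzO'⟩, d + d', P * Q' + Q * P', Q * Q',
    (hP.mul hQ').add (hQ.mul hP'), hQ.mul hQ', fun z' hz' => ?_⟩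
  obtain ⟨h1, h2⟩ := hPQ z' ⟨hz'.1, hz'.2.1⟩
  obtain ⟨h1', h2'⟩ := hPQ' z' ⟨hz'.1, hz'.2.2⟩
  exact ⟨by simp [h1, h1'], by
    simp only [h2, h2', Amb.eval_add, Amb.eval_mul, div_add_div _ _ h1 h1']⟩

theorem IsRegularFunction.neg (hf : IsRegularFunction X f) :
    IsRegularFunction X (fun z => - f z) :=
  ((isRegularFunction_const (-1)).mul hf).congr fun z _ => by simp

theorem IsRegularFunction.inv (hf : IsRegularFunction X f) (h0 : ∀ z ∈ X, f z ≠ 0) :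
    IsRegularFunction X (fun z => (f z)⁻¹) := by
  intro z hz
  obtain ⟨O, hO, hzO, d, P, Q, hP, hQ, hPQ⟩ := hf z hz
  refine ⟨O, hO, hzO, d, Q, P, hQ, hP, fun z' hz' => ?_⟩
  obtain ⟨h1, h2⟩ := hPQ z' hz'
  have h3 := h0 z' hz'.1
  rw [h2] at h3
  exact ⟨fun h => h3 (by simp [h]), by simp only [h2, inv_div]⟩

theorem IsRegularFunction.div (hf : IsRegularFunction X f) (hg : IsRegularFunction X g)
    (h0 : ∀ z ∈ X, g z ≠ 0) : IsRegularFunction X (fun z => f z / g z) :=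
  (hf.mul (hg.inv h0)).congr fun z _ => by simp [div_eq_mul_inv]

theorem IsRegularFunction.eval {σ : Type*} {F : Amb ι κ → σ → ℂ}
    (hF : ∀ j, IsRegularFunction X (fun z => F z j)) (P : MvPolynomial σ ℂ) :
    IsRegularFunction X (fun z => MvPolynomial.eval (F z) P) := by
  induction P using MvPolynomial.induction_on with
  | C a => simpa using isRegularFunction_const a
  | add p q hp hq => simpa using hp.add hq
  | mul_X p j hp => simpa using hp.mul (hF j)

/-- A regular function is non-zero on a neighbourhood of every point where it is non-zero. -/
theorem IsRegularFunction.exists_isOpen_ne (hf : IsRegularFunction X f) {z : Amb ι κ} (hz : z ∈ X)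
    (h0 : f z ≠ 0) : ∃ O : Set (Amb ι κ), IsOpen O ∧ z ∈ O ∧ ∀ z' ∈ X ∩ O, f z' ≠ 0 := by
  obtain ⟨O, hO, hzO, d, P, Q, hP, hQ, hPQ⟩ := hf z hz
  have h1 := hPQ z ⟨hz, hzO⟩
  refine ⟨O ∩ {z | z.eval P ≠ 0}, hO.inter (isOpen_eval_ne hP), ⟨hzO, fun h => h0 ?_⟩,
    fun z' hz' => ?_⟩
  · rw [h1.2, h, zero_div]
  · obtain ⟨h2, h3⟩ := hPQ z' ⟨hz'.1, hz'.2.1⟩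
    rw [h3]
    exact div_ne_zero hz'.2.2 h2

theorem IsRegularToP1.mono {f : Amb ι κ → P1} (hf : IsRegularToP1 X f) (h : X' ⊆ X) :
    IsRegularToP1 X' f := by
  intro z hz
  obtain ⟨O, hO, hzO, d, P, hP, hfP⟩ := hf z (h hz)
  exact ⟨O, hO, hzO, d, P, hP, fun z' hz' => hfP z' ⟨h hz'.1, hz'.2⟩⟩

theorem IsRegularToP1.congr {f g : Amb ι κ → P1} (hf : IsRegularToP1 X f) (h : Set.EqOn f g X) :
    IsRegularToP1 X g := by
  intro z hz
  obtain ⟨O, hO, hzO, d, P, hP, hfP⟩ := hf z hz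
  refine ⟨O, hO, hzO, d, P, hP, fun z' hz' => ?_⟩
  obtain ⟨h0, h1⟩ := hfP z' hz'
  exact ⟨h0, (h hz'.1).symm.trans h1⟩

theorem isRegularToP1_of_locally {f : Amb ι κ → P1}
    (h : ∀ z ∈ X, ∃ O : Set (Amb ι κ), IsOpen O ∧ z ∈ O ∧ IsRegularToP1 (X ∩ O) f) :
    IsRegularToP1 X f := by
  intro z hz
  obtain ⟨O, hO, hzO, hf⟩ := h z hz
  obtain ⟨O', hO', hzO', d, P, hP, hfP⟩ := hf z ⟨hz, hzO⟩
  exact ⟨O ∩ O', hO.inter hO', ⟨hzO, hzO'⟩, d, P, hP, fun z' hz' =>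
    hfP z' ⟨⟨hz'.1, hz'.2.1⟩, hz'.2.2⟩⟩

theorem isRegularToP1_proj (k : κ) : IsRegularToP1 X (fun z => z.proj k) := by
  classical
  refine fun z _ => ⟨Set.univ, isOpen_univ, trivial, Pi.single k 1,
    fun e => MvPolynomial.X (Sum.inr (k, e)), isMultihomogeneous_X_inr k, fun z' _ => ?_⟩
  have h : (fun e => z'.eval (MvPolynomial.X (Sum.inr (k, e)))) = (z'.proj k).rep := by
    funext e
    simp
  simp only [h]
  exact ⟨(z'.proj k).rep_nonzero, ((z'.proj k).mk_rep).symm⟩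

/-- Clearing denominators: `(P/Q, P'/Q')` is proportional to `(P Q', Q P')`, whose entries share the
multidegree `d + d'`. -/
theorem isRegularToP1_of_eq_mk {f : Amb ι κ → P1} {G : Amb ι κ → Fin 2 → ℂ}
    (hG : ∀ e, IsRegularFunction X (fun z => G z e))
    (hf : ∀ z ∈ X, ∃ h : G z ≠ 0, f z = Projectivization.mk ℂ (G z) h) : IsRegularToP1 X f := by
  intro z hz
  obtain ⟨O, hO, hzO, d, P, Q, hP, hQ, hPQ⟩ := hG 0 z hz
  obtain ⟨O', hO', hzO', d', P', Q', hP', hQ', hPQ'⟩ := hG 1 z hz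
  refine ⟨O ∩ O', hO.inter hO', ⟨hzO, hzO'⟩, d + d', ![P * Q', Q * P'],
    Fin.forall_fin_two.2 ⟨hP.mul hQ', hQ.mul hP'⟩, fun z' hz' => ?_⟩
  obtain ⟨h1, h2⟩ := hPQ z' ⟨hz'.1, hz'.2.1⟩
  obtain ⟨h1', h2'⟩ := hPQ' z' ⟨hz'.1, hz'.2.2⟩
  obtain ⟨h3, h4⟩ := hf z' hz'.1
  have key : (fun e => z'.eval ((![P * Q', Q * P'] : Fin 2 → Poly ι κ) e))
      = (z'.eval Q * z'.eval Q') • G z' := by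
    funext e
    fin_cases e
    · simp [h2]
      field_simp
    · simp [h2']
      field_simp
  have hne : z'.eval Q * z'.eval Q' ≠ 0 := mul_ne_zero h1 h1'
  rw [h4]
  simp only [key]
  exact ⟨smul_ne_zero hne h3,
    (Projectivization.mk_eq_mk_iff' ℂ _ _ _ _).2
      ⟨(z'.eval Q * z'.eval Q')⁻¹, by rw [smul_smul, inv_mul_cancel₀ hne, one_smul]⟩⟩

/-- Dividing both entries by one that does not vanish at `z` turns homogeneous polynomials into
regular functions. Together with the converse `isRegularToP1_of_eq_mk`, this allows maps to ℙ¹ to be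
composed. -/
theorem IsRegularToP1.exists_eq_mk {f : Amb ι κ → P1} (hf : IsRegularToP1 X f) {z : Amb ι κ}
    (hz : z ∈ X) : ∃ O : Set (Amb ι κ), IsOpen O ∧ z ∈ O ∧ ∃ G : Amb ι κ → Fin 2 → ℂ,
      (∀ e, IsRegularFunction (X ∩ O) (fun z => G z e)) ∧
      ∀ z' ∈ X ∩ O, ∃ h : G z' ≠ 0, f z' = Projectivization.mk ℂ (G z') h := by
  obtain ⟨O, hO, hzO, d, P, hP, hfP⟩ := hf z hz
  obtain ⟨h0, -⟩ := hfP z ⟨hz, hzO⟩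
  obtain ⟨e₀, he₀⟩ := Function.ne_iff.1 h0
  refine ⟨O ∩ {z | z.eval (P e₀) ≠ 0}, hO.inter (isOpen_eval_ne (hP e₀)), ⟨hzO, he₀⟩,
    fun z e => z.eval (P e) / z.eval (P e₀), fun e z' hz' => ?_, fun z' hz' => ?_⟩
  · exact ⟨Set.univ, isOpen_univ, trivial, d, P e, P e₀, hP e, hP e₀, fun p hp => ⟨hp.1.2.2, rfl⟩⟩
  · have hne : z'.eval (P e₀) ≠ 0 := hz'.2.2
    obtain ⟨h1, h2⟩ := hfP z' ⟨hz'.1, hz'.2.1⟩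
    have key : (fun e => z'.eval (P e) / z'.eval (P e₀))
        = (z'.eval (P e₀))⁻¹ • fun e => z'.eval (P e) := by
      funext e
      simp [div_eq_inv_mul]
    simp only [key]
    rw [h2]
    exact ⟨smul_ne_zero (inv_ne_zero hne) h1, (Projectivization.mk_eq_mk_iff' ℂ _ _ _ _).2
      ⟨z'.eval (P e₀), by rw [smul_smul, mul_inv_cancel₀ hne, one_smul]⟩⟩

end RegularFunctions

/-! ### Restriction of regular maps -/

section RestrictMaps

variable {ι κ ι' κ' : Type} [Fintype κ] {X X₁ : Set (Amb ι κ)} {Y : Set (Amb ι' κ')}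
  {f : Amb ι κ → Amb ι' κ'}

theorem IsRegularMap.mono (hf : IsRegularMap f X Y) (h : X₁ ⊆ X) {Y₁ : Set (Amb ι' κ')}
    (hm : Set.MapsTo f X₁ Y₁) : IsRegularMap f X₁ Y₁ :=
  ⟨hm, fun i => (hf.2.1 i).mono h, fun k => (hf.2.2 k).mono h⟩

end RestrictMaps

/-! ### Continuity, composition and restriction of regular maps -/

section RegularMaps

variable {ι κ ι' κ' ι'' κ'' : Type} [Fintype κ] [Fintype κ']
  {X : Set (Amb ι κ)} {Y : Set (Amb ι' κ')} {Z : Set (Amb ι'' κ'')}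
  {f : Amb ι κ → Amb ι' κ'} {g : Amb ι' κ' → Amb ι'' κ''}

/-- Near every point a regular map is given by regular functions, also in the homogeneous
coordinates. -/
theorem IsRegularMap.exists_coord (hf : IsRegularMap f X Y) {z : Amb ι κ} (hz : z ∈ X) :
    ∃ O : Set (Amb ι κ), IsOpen O ∧ z ∈ O ∧ ∃ F : Amb ι κ → ι' ⊕ κ' × Fin 2 → ℂ,
      (∀ j, IsRegularFunction (X ∩ O) (fun z => F z j)) ∧
      ∀ z' ∈ X ∩ O, ∃ c : κ' → ℂ, (∀ k, c k ≠ 0) ∧ ∀ (d : κ' → ℕ) (P : Poly ι' κ'),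
        IsMultihomogeneous d P →
          (f z').eval P = (∏ k, c k ^ d k) * MvPolynomial.eval (F z') P := by
  have h := fun k => (hf.2.2 k).exists_eq_mk hz
  choose O hO hzO G hG hfG using h
  refine ⟨⋂ k, O k, isOpen_iInter_of_finite hO, Set.mem_iInter.2 hzO,
    fun z => Sum.elim (f z).aff (fun a => G a.1 z a.2), ?_, fun z' hz' => ?_⟩
  · rintro (i | ⟨k, e⟩)
    · exact (hf.2.1 i).mono Set.inter_subset_left
    · exact (hG k e).mono (Set.inter_subset_inter_right _ (Set.iInter_subset _ k))
  · exact (f z').exists_eval_eq (fun k => G k z') fun k =>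
      hfG k z' ⟨hz'.1, Set.mem_iInter.1 hz'.2 k⟩

/-- In local coordinates `F`, the condition `P ≠ 0` at `f z` is the non-vanishing of the regular
function `P(F z)`, since the rescaling factor is non-zero. -/
theorem IsRegularMap.continuousOn (hf : IsRegularMap f X Y) : ContinuousOn f X := by
  rw [continuousOn_iff]
  intro z hz t ht hzt
  obtain ⟨d, P, hP, hPz, hPt⟩ := exists_eval_ne_subset ht hzt
  obtain ⟨O, hO, hzO, F, hF, hfF⟩ := hf.exists_coord hz
  obtain ⟨c, hc0, hc⟩ := hfF z ⟨hz, hzO⟩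
  rw [hc d P hP] at hPz
  obtain ⟨O', hO', hzO', hne⟩ := (IsRegularFunction.eval hF P).exists_isOpen_ne ⟨hz, hzO⟩
    (right_ne_zero_of_mul hPz)
  refine ⟨O ∩ O', hO.inter hO', ⟨hzO, hzO'⟩, fun z' hz' => hPt ?_⟩
  obtain ⟨c', hc0', hc'⟩ := hfF z' ⟨hz'.2, hz'.1.1⟩
  change (f z').eval P ≠ 0
  rw [hc' d P hP]
  exact mul_ne_zero (Finset.prod_ne_zero_iff.2 fun k _ => pow_ne_zero _ (hc0' k))
    (hne z' ⟨⟨hz'.2, hz'.1.1⟩, hz'.1.2⟩)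

theorem IsRegularMap.exists_isOpen (hf : IsRegularMap f X Y) {z : Amb ι κ} (hz : z ∈ X)
    {t : Set (Amb ι' κ')} (ht : IsOpen t) (hzt : f z ∈ t) :
    ∃ O : Set (Amb ι κ), IsOpen O ∧ z ∈ O ∧ ∀ z' ∈ X ∩ O, f z' ∈ t := by
  obtain ⟨O, hO, hzO, h⟩ := continuousOn_iff.1 hf.continuousOn z hz t ht hzt
  exact ⟨O, hO, hzO, fun z' hz' => h ⟨hz'.2, hz'.1⟩⟩

/-- Numerator and denominator have the same multidegree, so the unknown rescaling of homogeneous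
coordinates cancels in the quotient. -/
theorem IsRegularFunction.comp {g : Amb ι' κ' → ℂ} (hg : IsRegularFunction Y g)
    (hf : IsRegularMap f X Y) : IsRegularFunction X (fun z => g (f z)) := by
  refine isRegularFunction_of_locally fun z hz => ?_
  obtain ⟨t, ht, hzt, d, P, Q, hP, hQ, hPQ⟩ := hg (f z) (hf.1 hz)
  obtain ⟨O', hO', hzO', hft⟩ := hf.exists_isOpen hz ht hzt
  obtain ⟨O, hO, hzO, F, hF, hfF⟩ := hf.exists_coord hz
  have hval : ∀ z' ∈ X ∩ (O ∩ O'), MvPolynomial.eval (F z') Q ≠ 0 ∧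
      g (f z') = MvPolynomial.eval (F z') P / MvPolynomial.eval (F z') Q := by
    intro z' hz'
    obtain ⟨c, hc0, hc⟩ := hfF z' ⟨hz'.1, hz'.2.1⟩
    obtain ⟨h1, h2⟩ := hPQ (f z') ⟨hf.1 hz'.1, hft z' ⟨hz'.1, hz'.2.2⟩⟩
    rw [hc d Q hQ] at h1 h2
    rw [hc d P hP] at h2
    exact ⟨right_ne_zero_of_mul h1, by rw [h2, mul_div_mul_left _ _ (left_ne_zero_of_mul h1)]⟩
  have hF' : ∀ j, IsRegularFunction (X ∩ (O ∩ O')) (fun z => F z j) := fun j =>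
    (hF j).mono (Set.inter_subset_inter_right _ Set.inter_subset_left)
  exact ⟨O ∩ O', hO.inter hO', ⟨hzO, hzO'⟩,
    ((IsRegularFunction.eval hF' P).div (IsRegularFunction.eval hF' Q) fun z' hz' =>
      (hval z' hz').1).congr fun z' hz' => (hval z' hz').2.symm⟩

theorem IsRegularToP1.comp {g : Amb ι' κ' → P1} (hg : IsRegularToP1 Y g)
    (hf : IsRegularMap f X Y) : IsRegularToP1 X (fun z => g (f z)) := by
  refine isRegularToP1_of_locally fun z hz => ?_
  obtain ⟨t, ht, hzt, G, hG, hgG⟩ := hg.exists_eq_mk (hf.1 hz)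
  obtain ⟨O, hO, hzO, hft⟩ := hf.exists_isOpen hz ht hzt
  have hf' : IsRegularMap f (X ∩ O) (Y ∩ t) :=
    hf.mono Set.inter_subset_left fun z' hz' => ⟨hf.1 hz'.1, hft z' hz'⟩
  exact ⟨O, hO, hzO, isRegularToP1_of_eq_mk (G := fun z => G (f z)) (fun e => (hG e).comp hf')
    fun z' hz' => hgG (f z') (hf'.1 hz')⟩

theorem IsRegularMap.comp (hg : IsRegularMap g Y Z) (hf : IsRegularMap f X Y) :
    IsRegularMap (g ∘ f) X Z :=
  ⟨hg.1.comp hf.1, fun i => (hg.2.1 i).comp hf, fun k => (hg.2.2 k).comp hf⟩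

theorem isRegularMap_id : IsRegularMap id X X :=
  ⟨Set.mapsTo_id X, fun i => isRegularFunction_aff i, fun k => isRegularToP1_proj k⟩

theorem IsRegularIso.comp [Fintype κ''] (hg : IsRegularIso g Y Z) (hf : IsRegularIso f X Y) :
    IsRegularIso (g ∘ f) X Z := by
  obtain ⟨hf1, f', hf', hff'⟩ := hf
  obtain ⟨hg1, g', hg', hgg'⟩ := hg
  exact ⟨hg1.comp hf1, f' ∘ g', hf'.comp hg', hff'.1.comp hgg'.1 hf1.1,
    hff'.2.comp hgg'.2 hg'.1⟩

/-- The restriction of an isomorphism to the preimage of a subset. -/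
theorem IsRegularIso.restrict (hf : IsRegularIso f X Y) (V : Set (Amb ι' κ')) :
    IsRegularIso f (X ∩ f ⁻¹' V) (Y ∩ V) := by
  obtain ⟨hf1, f', hf', hff'⟩ := hf
  refine ⟨hf1.mono Set.inter_subset_left fun z hz => ⟨hf1.1 hz.1, hz.2⟩, f',
    hf'.mono Set.inter_subset_left fun z hz => ⟨hf'.1 hz.1, ?_⟩, ?_⟩
  · change f (f' z) ∈ V
    rw [hff'.2 hz.1]
    exact hz.2
  · exact hff'.mono Set.inter_subset_left Set.inter_subset_left

theorem isRegularMap_blowDown {X : Set (Amb ι κ)} {Y : Set (Amb ι (Fin 0))}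
    (h : Set.MapsTo blowDown X Y) : IsRegularMap blowDown X Y :=
  ⟨h, fun i => isRegularFunction_aff i, fun k => k.elim0⟩

end RegularMaps

/-! ### Points of the projective line by coordinates -/

section ProjectiveLine

/-- The point `[a : b]` of the projective line, for `a` and `b` not both zero. -/
def pt (a b : ℂ) : P1 :=
  if h : ![a, b] ≠ 0 then Projectivization.mk ℂ ![a, b] h
  -- A default making `pt` total; the lemmas on `pt` assume that `a` or `b` is non-zero.
  else Projectivization.mk ℂ ![1, 0] (by simp)

theorem vec_ne_zero {a b : ℂ} (h : a ≠ 0 ∨ b ≠ 0) : ![a, b] ≠ 0 := by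
  intro h0
  have h1 := congrFun h0 0
  have h2 := congrFun h0 1
  simp at h1 h2
  tauto

theorem exists_rep_pt {a b : ℂ} (h : a ≠ 0 ∨ b ≠ 0) :
    ∃ c : ℂ, c ≠ 0 ∧ (pt a b).rep 0 = c * a ∧ (pt a b).rep 1 = c * b := by
  have h0 := vec_ne_zero h
  obtain ⟨c, hc⟩ := Projectivization.exists_smul_eq_mk_rep ℂ ![a, b] h0
  rw [pt, dif_pos h0, ← hc]
  exact ⟨c, c.ne_zero, rfl, rfl⟩

theorem P1.rep_ne (p : P1) : p.rep 0 ≠ 0 ∨ p.rep 1 ≠ 0 := by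
  by_contra! h
  refine p.rep_nonzero ?_
  funext e
  fin_cases e
  · exact h.1
  · exact h.2

theorem P1.eq_pt {p : P1} {a b : ℂ} (h : a ≠ 0 ∨ b ≠ 0) (hp : p.rep 0 * b = p.rep 1 * a) :
    p = pt a b := by
  rw [pt, dif_pos (vec_ne_zero h)]
  conv_lhs => rw [← p.mk_rep]
  rw [Projectivization.mk_eq_mk_iff']
  rcases h with h | h
  · refine ⟨p.rep 0 / a, ?_⟩
    funext e
    fin_cases e
    · simp [h]
    · simp
      field_simp
      linear_combination hp
  · refine ⟨p.rep 1 / b, ?_⟩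
    funext e
    fin_cases e
    · simp
      field_simp
      linear_combination -hp
    · simp [h]

theorem P1.ext {p q : P1} (h : p.rep 0 * q.rep 1 = p.rep 1 * q.rep 0) : p = q := by
  have h1 : q = pt (q.rep 0) (q.rep 1) := P1.eq_pt q.rep_ne (mul_comm _ _)
  rw [h1]
  exact P1.eq_pt q.rep_ne h

variable {ι κ : Type} [Fintype κ] {X : Set (Amb ι κ)}

theorem isRegularToP1_pt {f g : Amb ι κ → ℂ} (hf : IsRegularFunction X f)
    (hg : IsRegularFunction X g) (h : ∀ z ∈ X, f z ≠ 0 ∨ g z ≠ 0) :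
    IsRegularToP1 X (fun z => pt (f z) (g z)) := by
  refine isRegularToP1_of_eq_mk (G := fun z => ![f z, g z]) (Fin.forall_fin_two.2 ⟨hf, hg⟩) ?_
  intro z hz
  exact ⟨vec_ne_zero (h z hz), dif_pos _⟩

end ProjectiveLine

/-- The affine coordinates with `(u_i, u_j, u_k) = (A, B, C)` for `(i, j, k) = (τ 0, τ 1, τ 2)`. -/
def affCoord (τ : Equiv.Perm (Fin 3)) (A B C y s : ℂ) : Coord → ℂ :=
  Sum.elim (fun m => ![A, B, C] (τ⁻¹ m)) ![y, s]

theorem affCoord_inl (τ : Equiv.Perm (Fin 3)) (A B C y s : ℂ) (n : Fin 3) :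
    affCoord τ A B C y s (Sum.inl (τ n)) = ![A, B, C] n := by
  simp [affCoord]

theorem affCoord_inr (τ : Equiv.Perm (Fin 3)) (A B C y s : ℂ) (n : Fin 2) :
    affCoord τ A B C y s (Sum.inr n) = ![y, s] n := rfl

theorem eq_affCoord {κ : Type} {z : Amb Coord κ} {τ : Equiv.Perm (Fin 3)} {A B C y s : ℂ}
    (hA : z.u (τ 0) = A) (hB : z.u (τ 1) = B) (hC : z.u (τ 2) = C) (hy : z.y = y) (hs : z.s = s) :
    z.aff = affCoord τ A B C y s := by
  funext j
  rcases j with m | k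
  · obtain ⟨n, rfl⟩ := τ.surjective m
    rw [affCoord_inl]
    fin_cases n
    · exact hA
    · exact hB
    · exact hC
  · fin_cases k
    · exact hy
    · exact hs

theorem isRegularFunction_affCoord {ι κ : Type} [Fintype κ] {X : Set (Amb ι κ)}
    (τ : Equiv.Perm (Fin 3)) {A B C y s : Amb ι κ → ℂ} (hA : IsRegularFunction X A)
    (hB : IsRegularFunction X B) (hC : IsRegularFunction X C) (hy : IsRegularFunction X y)
    (hs : IsRegularFunction X s) (i : Coord) :
    IsRegularFunction X (fun z => affCoord τ (A z) (B z) (C z) (y z) (s z) i) := by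
  rcases i with m | k
  · obtain ⟨n, rfl⟩ := τ.surjective m
    simp only [affCoord_inl]
    fin_cases n
    · exact hA
    · exact hB
    · exact hC
  · fin_cases k
    · exact hy
    · exact hs

/-! ### Affine charts of the six varieties, and the small resolution property -/

section Charts

/-- Affine space of dimension four. -/
abbrev A4 : Type := Amb (Fin 4) (Fin 0)

variable (τ : Equiv.Perm (Fin 3))

/-- The charts of `ℰ_{ij}`: affine coordinates `(σ₊/α₊, y, u_j, u_k)` for `α₊ ≠ 0`,
`(u_i, u_j, α₊/σ₊, α₋/σ₋)` for `σ₊, σ₋ ≠ 0` and `(σ₋/α₋, s, u_i, u_k)` for `α₋ ≠ 0`. -/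
def chart : Fin 3 → A4 → Amb Coord (Fin 2) :=
  ![fun v => ⟨affCoord τ (v.aff 0 * v.aff 1) (v.aff 2) (v.aff 3) (v.aff 1)
        (v.aff 0 * v.aff 2 * v.aff 3), ![pt 1 (v.aff 0), pt (v.aff 0 * v.aff 3) 1]⟩,
    fun v => ⟨affCoord τ (v.aff 0) (v.aff 1) (v.aff 2 * v.aff 3) (v.aff 0 * v.aff 2)
        (v.aff 1 * v.aff 3), ![pt (v.aff 2) 1, pt (v.aff 3) 1]⟩,
    fun v => ⟨affCoord τ (v.aff 2) (v.aff 0 * v.aff 1) (v.aff 3) (v.aff 0 * v.aff 2 * v.aff 3)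
        (v.aff 1), ![pt (v.aff 0 * v.aff 3) 1, pt 1 (v.aff 0)]⟩]

/-- The domains of the three charts. -/
def chartDom : Fin 3 → Set (Amb Coord (Fin 2)) :=
  ![{z | z.al 0 ≠ 0}, {z | z.si 0 ≠ 0 ∧ z.si 1 ≠ 0}, {z | z.al 1 ≠ 0}]

/-- The affine coordinates of the three charts. -/
def chartCoord : Fin 3 → Amb Coord (Fin 2) → A4 :=
  ![fun z => ⟨![z.si 0 / z.al 0, z.y, z.u (τ 1), z.u (τ 2)], Fin.elim0⟩,
    fun z => ⟨![z.u (τ 0), z.u (τ 1), z.al 0 / z.si 0, z.al 1 / z.si 1], Fin.elim0⟩,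
    fun z => ⟨![z.si 1 / z.al 1, z.s, z.u (τ 0), z.u (τ 2)], Fin.elim0⟩]

theorem isOpen_al_ne {ι κ : Type} [Fintype κ] (k : κ) : IsOpen {z : Amb ι κ | z.al k ≠ 0} := by
  classical
  have h := isOpen_eval_ne (isMultihomogeneous_X_inr (ι := ι) k 0)
  simp only [Amb.eval_X_inr] at h
  exact h

theorem isOpen_si_ne {ι κ : Type} [Fintype κ] (k : κ) : IsOpen {z : Amb ι κ | z.si k ≠ 0} := by
  classical
  have h := isOpen_eval_ne (isMultihomogeneous_X_inr (ι := ι) k 1)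
  simp only [Amb.eval_X_inr] at h
  exact h

theorem isOpen_aff_ne {ι κ : Type} [Fintype κ] (i : ι) : IsOpen {z : Amb ι κ | z.aff i ≠ 0} := by
  have h := isOpen_eval_ne (isMultihomogeneous_X_inl (κ := κ) i)
  simpa using h

theorem isOpen_chartDom (l : Fin 3) : IsOpen (chartDom l) := by
  fin_cases l
  · exact isOpen_al_ne 0
  · exact (isOpen_si_ne 0).inter (isOpen_si_ne 1)
  · exact isOpen_al_ne 1

theorem res_subset_iUnion_chartDom : res τ ⊆ ⋃ l, chartDom l := by
  rintro z ⟨-, -, -⟩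
  rw [Set.mem_iUnion]
  by_cases h0 : z.al 0 = 0
  · by_cases h1 : z.al 1 = 0
    · exact ⟨1, (z.proj 0).rep_ne.resolve_left (not_not.2 h0),
        (z.proj 1).rep_ne.resolve_left (not_not.2 h1)⟩
    · exact ⟨2, h1⟩
  · exact ⟨0, h0⟩

theorem P1.rep_pt_left_ne {a b : ℂ} (h : a ≠ 0) : (pt a b).rep 0 ≠ 0 := by
  obtain ⟨c, hc, h0, -⟩ := exists_rep_pt (a := a) (b := b) (Or.inl h)
  rw [h0]
  exact mul_ne_zero hc h

theorem P1.rep_pt_right_ne {a b : ℂ} (h : b ≠ 0) : (pt a b).rep 1 ≠ 0 := by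
  obtain ⟨c, hc, -, h0⟩ := exists_rep_pt (a := a) (b := b) (Or.inr h)
  rw [h0]
  exact mul_ne_zero hc h

theorem P1.rep_pt_mul {a b : ℂ} (h : a ≠ 0 ∨ b ≠ 0) :
    (pt a b).rep 0 * b = (pt a b).rep 1 * a := by
  obtain ⟨c, -, h0, h1⟩ := exists_rep_pt h
  rw [h0, h1]
  ring

theorem P1.rep_pt_div {a b : ℂ} (h : b ≠ 0) : (pt a b).rep 0 / (pt a b).rep 1 = a / b := by
  rw [div_eq_div_iff (P1.rep_pt_right_ne h) h, P1.rep_pt_mul (Or.inr h), mul_comm]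

theorem P1.rep_pt_div' {a b : ℂ} (h : a ≠ 0) : (pt a b).rep 1 / (pt a b).rep 0 = b / a := by
  rw [div_eq_div_iff (P1.rep_pt_left_ne h) h, ← P1.rep_pt_mul (Or.inl h), mul_comm]

theorem chart_mem (l : Fin 3) (v : A4) : chart τ l v ∈ res τ ∩ chartDom l := by
  fin_cases l
  · obtain ⟨c, hc, h0, h1⟩ := exists_rep_pt (a := 1) (b := v.aff 0) (Or.inl one_ne_zero)
    obtain ⟨c', hc', h0', h1'⟩ :=
      exists_rep_pt (a := v.aff 0 * v.aff 3) (b := 1) (Or.inr one_ne_zero)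
    simp [chart, chartDom, res, Amb.u, Amb.y, Amb.s, Amb.al, Amb.si, affCoord_inl, affCoord_inr,
      h0, h1, h0', h1', hc]
    exact ⟨by ring, by ring, by ring⟩
  · obtain ⟨c, hc, h0, h1⟩ := exists_rep_pt (a := v.aff 2) (b := 1) (Or.inr one_ne_zero)
    obtain ⟨c', hc', h0', h1'⟩ := exists_rep_pt (a := v.aff 3) (b := 1) (Or.inr one_ne_zero)
    simp [chart, chartDom, res, Amb.u, Amb.y, Amb.s, Amb.al, Amb.si, affCoord_inl, affCoord_inr,
      h0, h1, h0', h1', hc, hc']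
    exact ⟨by ring, by ring, by ring⟩
  · obtain ⟨c, hc, h0, h1⟩ := exists_rep_pt (a := 1) (b := v.aff 0) (Or.inl one_ne_zero)
    obtain ⟨c', hc', h0', h1'⟩ :=
      exists_rep_pt (a := v.aff 0 * v.aff 3) (b := 1) (Or.inr one_ne_zero)
    simp [chart, chartDom, res, Amb.u, Amb.y, Amb.s, Amb.al, Amb.si, affCoord_inl, affCoord_inr,
      h0, h1, h0', h1', hc]
    exact ⟨by ring, by ring, by ring⟩

theorem isRegularMap_chart (l : Fin 3) :
    IsRegularMap (chart τ l) Set.univ (res τ ∩ chartDom l) := by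
  have a : ∀ i, IsRegularFunction (Set.univ : Set A4) (fun z => z.aff i) := isRegularFunction_aff
  have one := isRegularFunction_const (X := (Set.univ : Set A4)) 1
  refine ⟨fun v _ => chart_mem τ l v, ?_, ?_⟩
  · fin_cases l
    · exact isRegularFunction_affCoord τ ((a 0).mul (a 1)) (a 2) (a 3) (a 1)
        (((a 0).mul (a 2)).mul (a 3))
    · exact isRegularFunction_affCoord τ (a 0) (a 1) ((a 2).mul (a 3)) ((a 0).mul (a 2))
        ((a 1).mul (a 3))
    · exact isRegularFunction_affCoord τ (a 2) ((a 0).mul (a 1)) (a 3)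
        (((a 0).mul (a 2)).mul (a 3)) (a 1)
  · fin_cases l
    · exact Fin.forall_fin_two.2
        ⟨isRegularToP1_pt one (a 0) fun _ _ => Or.inl one_ne_zero,
          isRegularToP1_pt ((a 0).mul (a 3)) one fun _ _ => Or.inr one_ne_zero⟩
    · exact Fin.forall_fin_two.2
        ⟨isRegularToP1_pt (a 2) one fun _ _ => Or.inr one_ne_zero,
          isRegularToP1_pt (a 3) one fun _ _ => Or.inr one_ne_zero⟩
    · exact Fin.forall_fin_two.2
        ⟨isRegularToP1_pt ((a 0).mul (a 3)) one fun _ _ => Or.inr one_ne_zero,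
          isRegularToP1_pt one (a 0) fun _ _ => Or.inl one_ne_zero⟩

theorem isRegularMap_chartCoord (l : Fin 3) :
    IsRegularMap (chartCoord τ l) (res τ ∩ chartDom l) Set.univ := by
  refine ⟨Set.mapsTo_univ _ _, ?_, fun k => k.elim0⟩
  fin_cases l
  · intro i
    fin_cases i
    · exact isRegularFunction_rep_div 0 1 0 fun z hz => hz.2
    all_goals exact isRegularFunction_aff _
  · intro i
    fin_cases i
    · exact isRegularFunction_aff _
    · exact isRegularFunction_aff _
    · exact isRegularFunction_rep_div 0 0 1 fun z hz => hz.2.1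
    · exact isRegularFunction_rep_div 1 0 1 fun z hz => hz.2.2
  · intro i
    fin_cases i
    · exact isRegularFunction_rep_div 1 1 0 fun z hz => hz.2
    all_goals exact isRegularFunction_aff _

theorem Amb.ext_affine {n : ℕ} {v w : Amb (Fin n) (Fin 0)} (h : ∀ i, v.aff i = w.aff i) :
    v = w := Amb.ext (funext h) (Subsingleton.elim _ _)

theorem chartCoord_chart (l : Fin 3) (v : A4) : chartCoord τ l (chart τ l v) = v := by
  refine Amb.ext_affine fun i => ?_
  fin_cases l <;> fin_cases i <;>
    simp [chart, chartCoord, Amb.u, Amb.y, Amb.s, Amb.al, Amb.si, affCoord_inl, affCoord_inr,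
      P1.rep_pt_div, P1.rep_pt_div']

theorem chart_chartCoord (l : Fin 3) {z : Amb Coord (Fin 2)} (hz : z ∈ res τ)
    (hl : z ∈ chartDom l) : chart τ l (chartCoord τ l z) = z := by
  obtain ⟨h1, h2, h3⟩ := hz
  symm
  fin_cases l
  · have ha : z.al 0 ≠ 0 := hl
    -- If `α₊ ≠ 0`, the third equation turns `σ₋ = 0` into `α₋ = 0`, which is impossible. Hence this
    -- chart needs no condition on the second line.
    have hs : z.si 1 ≠ 0 := fun h => by
      have h4 : z.al 1 = 0 := by simpa [h, ha] using h3
      exact (z.proj 1).rep_ne.elim (fun h5 => h5 h4) (fun h5 => h5 h)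
    ext1
    · refine eq_affCoord ?_ rfl rfl rfl ?_ <;> simp [chartCoord]
      · field_simp
        linear_combination h1
      · field_simp
        -- The equations involve `s` only through `σ₋ s`, so the identity is checked after
        -- multiplication by `σ₋`.
        refine mul_left_cancel₀ hs ?_
        linear_combination (- z.al 0) * h2 + z.u (τ 1) * h3
    · funext k
      fin_cases k
      · refine P1.eq_pt (Or.inl one_ne_zero) ?_
        change z.al 0 * (z.si 0 / z.al 0) = z.si 0 * 1
        field_simp
      · refine P1.eq_pt (Or.inr one_ne_zero) ?_
        change z.al 1 * 1 = z.si 1 * (z.si 0 / z.al 0 * z.u (τ 2))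
        field_simp
        linear_combination h3
  · have ha : z.si 0 ≠ 0 := hl.1
    have hb : z.si 1 ≠ 0 := hl.2
    ext1
    · refine eq_affCoord rfl rfl ?_ ?_ ?_ <;> simp [chartCoord] <;> field_simp
      · linear_combination -h3
      · linear_combination -h1
      · linear_combination -h2
    · funext k
      fin_cases k
      · refine P1.eq_pt (Or.inr one_ne_zero) ?_
        change z.al 0 * 1 = z.si 0 * (z.al 0 / z.si 0)
        field_simp
      · refine P1.eq_pt (Or.inr one_ne_zero) ?_
        change z.al 1 * 1 = z.si 1 * (z.al 1 / z.si 1)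
        field_simp
  · have ha : z.al 1 ≠ 0 := hl
    have hs : z.si 0 ≠ 0 := fun h => by
      have h4 : z.al 0 = 0 := by simpa [h, ha] using h3
      exact (z.proj 0).rep_ne.elim (fun h5 => h5 h4) (fun h5 => h5 h)
    ext1
    · refine eq_affCoord rfl ?_ rfl ?_ rfl <;> simp [chartCoord]
      · field_simp
        linear_combination h2
      · field_simp
        refine mul_left_cancel₀ hs ?_
        linear_combination (- z.al 1) * h1 + z.u (τ 0) * h3
    · funext k
      fin_cases k
      · refine P1.eq_pt (Or.inr one_ne_zero) ?_
        change z.al 0 * 1 = z.si 0 * (z.si 1 / z.al 1 * z.u (τ 2))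
        field_simp
        linear_combination h3
      · refine P1.eq_pt (Or.inl one_ne_zero) ?_
        change z.al 1 * (z.si 1 / z.al 1) = z.si 1 * 1
        field_simp

theorem isRegularIso_chartCoord (l : Fin 3) :
    IsRegularIso (chartCoord τ l) (res τ ∩ chartDom l) Set.univ :=
  ⟨isRegularMap_chartCoord τ l, chart τ l, isRegularMap_chart τ l,
    fun _ hz => chart_chartCoord τ l hz.1 hz.2, fun v _ => chartCoord_chart τ l v⟩

theorem image_chart_univ (l : Fin 3) : chart τ l '' Set.univ = res τ ∩ chartDom l := by
  refine Set.Subset.antisymm ?_ fun z hz => ⟨chartCoord τ l z, trivial, ?_⟩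
  · rintro _ ⟨v, -, rfl⟩
    exact chart_mem τ l v
  · exact chart_chartCoord τ l hz.1 hz.2

theorem isIrreducible_res : IsIrreducible (res τ) := by
  refine isIrreducible_of_cover isOpen_chartDom (res_subset_iUnion_chartDom τ) (fun l => ?_)
    fun l l' => ?_
  · rw [← image_chart_univ]
    exact isIrreducible_univ_affineSpace.image _ (isRegularMap_chart τ l).continuousOn
  -- The point of the middle chart with all coordinates `1` has all homogeneous coordinates
  -- non-zero, so it lies in every chart.
  · refine ⟨chart τ 1 ⟨fun _ => 1, Fin.elim0⟩, (chart_mem τ 1 _).1, ?_⟩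
    have h1 : (pt 1 1).rep 0 ≠ 0 := P1.rep_pt_left_ne one_ne_zero
    have h2 : (pt 1 1).rep 1 ≠ 0 := P1.rep_pt_right_ne one_ne_zero
    have h : ∀ l, chart τ 1 ⟨fun _ => 1, Fin.elim0⟩ ∈ chartDom l := by
      intro l
      fin_cases l
      · exact h1
      · exact ⟨h2, h2⟩
      · exact h1
    exact ⟨h l, h l'⟩

theorem isClosed_res : IsClosed (res τ) := by
  have u : ∀ m : Fin 3, IsMultihomogeneous (0 : Fin 2 → ℕ)
      (MvPolynomial.X (Sum.inl (Sum.inl m)) : Poly Coord (Fin 2)) :=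
    fun m => isMultihomogeneous_X_inl _
  have v : ∀ m : Fin 2, IsMultihomogeneous (0 : Fin 2 → ℕ)
      (MvPolynomial.X (Sum.inl (Sum.inr m)) : Poly Coord (Fin 2)) :=
    fun m => isMultihomogeneous_X_inl _
  have r : ∀ k e : Fin 2, IsMultihomogeneous (Pi.single k 1)
      (MvPolynomial.X (Sum.inr (k, e)) : Poly Coord (Fin 2)) := isMultihomogeneous_X_inr
  have e1 := isClosed_eval_eq ((r 0 0).mul (u (τ 0))) ((r 0 1).mul (v 0))
  have e2 := isClosed_eval_eq ((r 1 0).mul (u (τ 1))) ((r 1 1).mul (v 1))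
  have e3 := isClosed_eval_eq ((r 0 0).mul (r 1 0))
    (by simpa using ((r 0 1).mul (r 1 1)).mul (u (τ 2)))
  convert (e1.inter e2).inter e3 using 1
  ext z
  simp [res, Amb.al, Amb.si, Amb.u, Amb.y, Amb.s, and_assoc, mul_comm]

/-! ### The blow-down: inverse over `y ≠ 0` and `s ≠ 0`, surjectivity, exceptional locus -/

theorem prod_u {κ : Type} (z : Amb Coord κ) :
    z.u 0 * z.u 1 * z.u 2 = z.u (τ 0) * z.u (τ 1) * z.u (τ 2) := by
  have e : ∏ m, z.u (τ m) = ∏ m, z.u m := Equiv.prod_comp τ z.u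
  rw [Fin.prod_univ_three, Fin.prod_univ_three] at e
  exact e.symm

theorem mapsTo_blowDown_res : Set.MapsTo blowDown (res τ) binomial := by
  intro z hz
  obtain ⟨l, hl⟩ := Set.mem_iUnion.1 (res_subset_iUnion_chartDom τ hz)
  rw [← chart_chartCoord τ l hz hl]
  generalize chartCoord τ l z = v
  change _ = _
  rw [prod_u τ]
  fin_cases l <;>
    simp [chart, blowDown, Amb.u, Amb.y, Amb.s, affCoord_inl, affCoord_inr] <;> ring

/-- The inverse of the blow-down over the locus `y ≠ 0`. -/
def sectionY (p : Amb Coord (Fin 0)) : Amb Coord (Fin 2) :=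
  ⟨p.aff, ![pt p.y (p.u (τ 0)), pt (p.u (τ 0) * p.u (τ 2)) p.y]⟩

/-- The inverse of the blow-down over the locus `s ≠ 0`. -/
def sectionS (p : Amb Coord (Fin 0)) : Amb Coord (Fin 2) :=
  ⟨p.aff, ![pt (p.u (τ 1) * p.u (τ 2)) p.s, pt p.s (p.u (τ 1))]⟩

theorem sectionY_mem {p : Amb Coord (Fin 0)} (hp : p ∈ binomial) (hy : p.y ≠ 0) :
    sectionY τ p ∈ res τ := by
  obtain ⟨c, -, h0, h1⟩ := exists_rep_pt (a := p.y) (b := p.u (τ 0)) (Or.inl hy)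
  obtain ⟨c', -, h0', h1'⟩ :=
    exists_rep_pt (a := p.u (τ 0) * p.u (τ 2)) (b := p.y) (Or.inr hy)
  have h : p.y * p.s = _ := hp.trans (prod_u τ p)
  refine ⟨?_, ?_, ?_⟩
  · change p.u (τ 0) * (pt _ _).rep 0 = (pt _ _).rep 1 * p.y
    rw [h0, h1]
    ring
  · change p.u (τ 1) * (pt _ _).rep 0 = (pt _ _).rep 1 * p.s
    rw [h0', h1']
    linear_combination -c' * h
  · change (pt _ _).rep 0 * (pt _ _).rep 0 = (pt _ _).rep 1 * (pt _ _).rep 1 * p.u (τ 2)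
    rw [h0, h1, h0', h1']
    ring

theorem sectionS_mem {p : Amb Coord (Fin 0)} (hp : p ∈ binomial) (hs : p.s ≠ 0) :
    sectionS τ p ∈ res τ := by
  obtain ⟨c, -, h0, h1⟩ := exists_rep_pt (a := p.s) (b := p.u (τ 1)) (Or.inl hs)
  obtain ⟨c', -, h0', h1'⟩ :=
    exists_rep_pt (a := p.u (τ 1) * p.u (τ 2)) (b := p.s) (Or.inr hs)
  have h : p.y * p.s = _ := hp.trans (prod_u τ p)
  refine ⟨?_, ?_, ?_⟩
  · change p.u (τ 0) * (pt _ _).rep 0 = (pt _ _).rep 1 * p.y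
    rw [h0', h1']
    linear_combination -c' * h
  · change p.u (τ 1) * (pt _ _).rep 0 = (pt _ _).rep 1 * p.s
    rw [h0, h1]
    ring
  · change (pt _ _).rep 0 * (pt _ _).rep 0 = (pt _ _).rep 1 * (pt _ _).rep 1 * p.u (τ 2)
    rw [h0, h1, h0', h1']
    ring

theorem al_ne_or_si_ne {ι κ : Type} (z : Amb ι κ) (k : κ) : z.al k ≠ 0 ∨ z.si k ≠ 0 :=
  (z.proj k).rep_ne

/-- The first equation gives `[α₊ : σ₊] = [y : u_i]`. Substituted into the third equation, this
gives `[α₋ : σ₋] = [u_i u_k : y]`; the second equation alone would not suffice when `u_j = s = 0`.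
-/
theorem sectionY_blowDown {z : Amb Coord (Fin 2)} (hz : z ∈ res τ) (hy : z.y ≠ 0) :
    sectionY τ (blowDown z) = z := by
  obtain ⟨h1, h2, h3⟩ := hz
  symm
  ext1
  · rfl
  · funext k
    fin_cases k
    · refine P1.eq_pt (Or.inl hy) ?_
      change z.al 0 * z.u (τ 0) = z.si 0 * z.y
      linear_combination h1
    · refine P1.eq_pt (Or.inr hy) ?_
      change z.al 1 * z.y = z.si 1 * (z.u (τ 0) * z.u (τ 2))
      -- One of `α₊`, `σ₊` is non-zero, and the identity times either of them follows from the first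
      -- and third equations.
      rcases al_ne_or_si_ne z 0 with h | h <;> refine mul_left_cancel₀ h ?_
      · linear_combination z.y * h3 - z.si 1 * z.u (τ 2) * h1
      · linear_combination z.u (τ 0) * h3 - z.al 1 * h1

theorem sectionS_blowDown {z : Amb Coord (Fin 2)} (hz : z ∈ res τ) (hs : z.s ≠ 0) :
    sectionS τ (blowDown z) = z := by
  obtain ⟨h1, h2, h3⟩ := hz
  symm
  ext1
  · rfl
  · funext k
    fin_cases k
    · refine P1.eq_pt (Or.inr hs) ?_
      change z.al 0 * z.s = z.si 0 * (z.u (τ 1) * z.u (τ 2))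
      rcases al_ne_or_si_ne z 1 with h | h <;> refine mul_left_cancel₀ h ?_
      · linear_combination z.s * h3 - z.si 0 * z.u (τ 2) * h2
      · linear_combination z.u (τ 1) * h3 - z.al 0 * h2
    · refine P1.eq_pt (Or.inl hs) ?_
      change z.al 1 * z.u (τ 1) = z.si 1 * z.s
      linear_combination h2

theorem mem_isoLocus_of_y_ne {p : Amb Coord (Fin 0)} (hp : p ∈ binomial) (hy : p.y ≠ 0) :
    p ∈ isoLocus blowDown (res τ) binomial := by
  refine ⟨hp, {q | q.y ≠ 0}, isOpen_aff_ne (Sum.inr 0), hy, ?_⟩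
  refine ⟨isRegularMap_blowDown fun z hz => ⟨mapsTo_blowDown_res τ hz.1, hz.2⟩, sectionY τ,
    ⟨fun q hq => ⟨sectionY_mem τ hq.1 hq.2, hq.2⟩, fun i => isRegularFunction_aff i,
      Fin.forall_fin_two.2 ⟨?_, ?_⟩⟩,
    fun z hz => sectionY_blowDown τ hz.1 hz.2,
    fun q _ => Amb.ext rfl (Subsingleton.elim _ _)⟩
  · exact isRegularToP1_pt (isRegularFunction_aff _) (isRegularFunction_aff _)
      fun q hq => Or.inl hq.2
  · exact isRegularToP1_pt ((isRegularFunction_aff _).mul (isRegularFunction_aff _))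
      (isRegularFunction_aff _) fun q hq => Or.inr hq.2

theorem mem_isoLocus_of_s_ne {p : Amb Coord (Fin 0)} (hp : p ∈ binomial) (hs : p.s ≠ 0) :
    p ∈ isoLocus blowDown (res τ) binomial := by
  refine ⟨hp, {q | q.s ≠ 0}, isOpen_aff_ne (Sum.inr 1), hs, ?_⟩
  refine ⟨isRegularMap_blowDown fun z hz => ⟨mapsTo_blowDown_res τ hz.1, hz.2⟩, sectionS τ,
    ⟨fun q hq => ⟨sectionS_mem τ hq.1 hq.2, hq.2⟩, fun i => isRegularFunction_aff i,
      Fin.forall_fin_two.2 ⟨?_, ?_⟩⟩,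
    fun z hz => sectionS_blowDown τ hz.1 hz.2,
    fun q _ => Amb.ext rfl (Subsingleton.elim _ _)⟩
  · exact isRegularToP1_pt ((isRegularFunction_aff _).mul (isRegularFunction_aff _))
      (isRegularFunction_aff _) fun q hq => Or.inr hq.2
  · exact isRegularToP1_pt (isRegularFunction_aff _) (isRegularFunction_aff _)
      fun q hq => Or.inl hq.2

theorem surjOn_blowDown_res : Set.SurjOn blowDown (res τ) binomial := by
  intro p hp
  by_cases hy : p.y = 0
  · by_cases hs : p.s = 0
    · have h : p.y * p.s = _ := hp.trans (prod_u τ p)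
      obtain ⟨c, -, c0, c1⟩ := exists_rep_pt (a := 0) (b := 1) (Or.inr one_ne_zero)
      obtain ⟨c', -, c0', c1'⟩ := exists_rep_pt (a := 1) (b := 0) (Or.inl one_ne_zero)
      rw [hy, zero_mul, eq_comm, mul_eq_zero, mul_eq_zero] at h
      simp only [Amb.u] at h
      -- When `y = s = 0` some `u` vanishes; for each of the three a pair of coordinate points `[1 :
      -- 0]`, `[0 : 1]` satisfies the equations.
      obtain ⟨P, hP⟩ : ∃ P, (⟨p.aff, P⟩ : Amb Coord (Fin 2)) ∈ res τ := by
        rcases h with (h | h) | h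
        · refine ⟨![pt 1 0, pt 0 1], ?_⟩
          simp [res, Amb.u, Amb.y, Amb.s, Amb.al, Amb.si, c0, c1', h] at hy hs ⊢
          simp [hs]
        · refine ⟨![pt 0 1, pt 1 0], ?_⟩
          simp [res, Amb.u, Amb.y, Amb.s, Amb.al, Amb.si, c0, c1', h] at hy hs ⊢
          simp [hy]
        · refine ⟨![pt 0 1, pt 0 1], ?_⟩
          simp [res, Amb.u, Amb.y, Amb.s, Amb.al, Amb.si, c0, h] at hy hs ⊢
          simp [hs, hy]
      exact ⟨_, hP, Amb.ext rfl (Subsingleton.elim _ _)⟩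
    · exact ⟨_, sectionS_mem τ hp hs, Amb.ext rfl (Subsingleton.elim _ _)⟩
  · exact ⟨_, sectionY_mem τ hp hy, Amb.ext rfl (Subsingleton.elim _ _)⟩

/-- It is the continuous image of an irreducible resolution. -/
theorem isIrreducible_binomial : IsIrreducible binomial := by
  have h := (isIrreducible_res 1).image _
    (isRegularMap_blowDown (mapsTo_blowDown_res 1)).continuousOn
  rwa [(surjOn_blowDown_res 1).image_eq_of_mapsTo (mapsTo_blowDown_res 1)] at h

theorem binomial_subset_closure_isoLocus :
    binomial ⊆ closure (isoLocus blowDown (res τ) binomial) := by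
  intro p hp
  rw [mem_closure_iff]
  intro O hO hpO
  -- The point with all coordinates `1` shows that `y ≠ 0` is non-empty, hence dense in the
  -- irreducible binomial variety.
  have hmem : (⟨Sum.elim (fun _ => 1) ![1, 1], Fin.elim0⟩ : Amb Coord (Fin 0)) ∈ binomial := by
    simp [binomial, Amb.y, Amb.s, Amb.u]
  obtain ⟨q, hq, hqO, hqy⟩ := isIrreducible_binomial.2 O {q | q.y ≠ 0} hO
    (isOpen_aff_ne (Sum.inr 0)) ⟨p, hp, hpO⟩ ⟨_, hmem, by simp [Amb.y]⟩
  exact ⟨q, hqO, mem_isoLocus_of_y_ne τ hq hqy⟩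

/-- The pairs of a chart and a coordinate that vanishes on a component of `y = 0`. -/
def divisorIndex : Finset (Fin 3 × Fin 4) := {(0, 1), (1, 0), (1, 2), (2, 0), (2, 2), (2, 3)}

/-- The closure of a coordinate hyperplane in a chart. -/
def divisor (a : Fin 3 × Fin 4) : Set (Amb Coord (Fin 2)) :=
  closure (chart τ a.1 '' {v | v.aff a.2 = 0})

/-- The hyperplane is the image of affine space under the map that sets one coordinate to zero. -/
theorem isIrreducible_hyperplane {n : ℕ} (m : Fin n) :
    IsIrreducible {v : Amb (Fin n) (Fin 0) | v.aff m = 0} := by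
  have h : IsRegularMap
      (fun v : Amb (Fin n) (Fin 0) => (⟨Function.update v.aff m 0, Fin.elim0⟩ : Amb _ (Fin 0)))
      Set.univ {v | v.aff m = 0} := by
    refine ⟨fun v _ => by simp, fun i => ?_, fun k => k.elim0⟩
    by_cases hi : i = m
    · subst hi
      simpa using isRegularFunction_const 0
    · simpa [hi] using isRegularFunction_aff i
  have h' := isIrreducible_univ_affineSpace.image _ h.continuousOn
  convert h' using 1
  ext v
  refine ⟨fun hv => ⟨v, trivial, Amb.ext_affine fun i => ?_⟩, ?_⟩
  · by_cases hi : i = m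
    · subst hi
      simpa using Eq.symm hv
    · simp [hi]
  · rintro ⟨v, -, rfl⟩
    exact h.1 trivial

theorem isIrreducible_divisor (a : Fin 3 × Fin 4) : IsIrreducible (divisor τ a) :=
  ((isIrreducible_hyperplane a.2).image _
    ((isRegularMap_chart τ a.1).continuousOn.mono (Set.subset_univ _))).closure

theorem isClosed_y_eq_zero : IsClosed {z : Amb Coord (Fin 2) | z.y = 0} := by
  have h := (isOpen_aff_ne (ι := Coord) (κ := Fin 2) (Sum.inr 0)).isClosed_compl
  convert h using 1
  ext z
  simp [Amb.y]

theorem divisor_subset {a : Fin 3 × Fin 4} (ha : a ∈ divisorIndex) :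
    divisor τ a ⊆ res τ ∩ {z | z.y = 0} := by
  refine closure_minimal ?_ ((isClosed_res τ).inter isClosed_y_eq_zero)
  rintro _ ⟨v, hv, rfl⟩
  refine ⟨(chart_mem τ a.1 v).1, ?_⟩
  simp [divisorIndex] at ha
  rcases ha with rfl | rfl | rfl | rfl | rfl | rfl <;> simp at hv <;>
    simp [chart, Amb.y, affCoord_inr, hv]

/-- The monomials for `y` and `s` in a chart have no common variable, so killing one variable of `y`
and setting the others to `1` leaves `s = 1`. This is what makes the resolution small. -/
theorem exists_mem_divisor_s_ne {a : Fin 3 × Fin 4} (ha : a ∈ divisorIndex) :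
    ∃ z ∈ divisor τ a, z.s ≠ 0 := by
  refine ⟨chart τ a.1 ⟨Function.update (fun _ => 1) a.2 0, Fin.elim0⟩,
    subset_closure ⟨_, by simp, rfl⟩, ?_⟩
  simp [divisorIndex] at ha
  rcases ha with rfl | rfl | rfl | rfl | rfl | rfl <;>
    simp [chart, Amb.s, affCoord_inr, Function.update]

theorem subset_iUnion_divisor : res τ ∩ {z | z.y = 0} ⊆ ⋃ a ∈ divisorIndex, divisor τ a := by
  rintro z ⟨hz, hy⟩
  obtain ⟨l, hl⟩ := Set.mem_iUnion.1 (res_subset_iUnion_chartDom τ hz)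
  rw [← chart_chartCoord τ l hz hl] at hy ⊢
  generalize chartCoord τ l z = v at hy ⊢
  suffices h : ∃ m, (l, m) ∈ divisorIndex ∧ v.aff m = 0 by
    obtain ⟨m, h1, h2⟩ := h
    exact Set.mem_biUnion h1 (subset_closure ⟨v, h2, rfl⟩)
  fin_cases l <;>
    simp [chart, Amb.y, affCoord_inr, or_assoc] at hy <;>
    simp [divisorIndex, hy]

/-- An irreducible `T` in the exceptional locus lies in one of the finitely many divisors covering
`y = 0`. The chain is `T`, that divisor, `res τ`: the first inclusion is strict because `s` vanishes
on `T` but not on the divisor, the second because `y` vanishes on the divisor but not on `res τ`. -/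
theorem codimAtLeastTwo_exceptionalLocus :
    CodimAtLeastTwo (exceptionalLocus blowDown (res τ) binomial) (res τ) := by
  intro T hTE hT hTirr
  have hTX : T ⊆ res τ := fun z hz => (hTE hz).1
  have hTy : ∀ z ∈ T, z.y = 0 := by
    intro z hz
    by_contra h
    exact (hTE hz).2 (mem_isoLocus_of_y_ne τ (mapsTo_blowDown_res τ (hTX hz)) h)
  have hTs : ∀ z ∈ T, z.s = 0 := by
    intro z hz
    by_contra h
    exact (hTE hz).2 (mem_isoLocus_of_s_ne τ (mapsTo_blowDown_res τ (hTX hz)) h)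
  obtain ⟨a, ha, hTa⟩ : ∃ a ∈ divisorIndex, T ⊆ divisor τ a := by
    have h := isIrreducible_iff_sUnion_isClosed.1 hTirr (divisorIndex.image (divisor τ)) ?_ ?_
    · obtain ⟨D, hD, hTD⟩ := h
      obtain ⟨a, ha, rfl⟩ := Finset.mem_image.1 hD
      exact ⟨a, ha, hTD⟩
    · intro D hD
      obtain ⟨a, ha, rfl⟩ := Finset.mem_image.1 hD
      exact isClosed_closure
    · intro z hz
      have h := subset_iUnion_divisor τ ⟨hTX hz, hTy z hz⟩
      simpa using h
  refine ⟨divisor τ a, res τ, isClosed_closure, isIrreducible_divisor τ a, isClosed_res τ,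
    isIrreducible_res τ, ?_, ?_, subset_rfl⟩
  · refine ⟨hTa, fun h => ?_⟩
    obtain ⟨z, hz, hzs⟩ := exists_mem_divisor_s_ne τ ha
    exact hzs (hTs z (h hz))
  · refine ⟨(divisor_subset τ ha).trans Set.inter_subset_left, fun h => ?_⟩
    have h1 := (divisor_subset τ ha (h (chart_mem τ 1 ⟨fun _ => 1, Fin.elim0⟩).1)).2
    simp [chart, Amb.y, affCoord_inr] at h1

theorem isSmallResolution_res : IsSmallResolution 4 (res τ) binomial where
  closed := isClosed_res τ
  irreducible := isIrreducible_res τ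
  smooth := by
    intro z hz
    obtain ⟨l, hl⟩ := Set.mem_iUnion.1 (res_subset_iUnion_chartDom τ hz)
    exact ⟨chartDom l, isOpen_chartDom l, hl, Set.univ, isOpen_univ, chartCoord τ l,
      isRegularIso_chartCoord τ l⟩
  regular := isRegularMap_blowDown (mapsTo_blowDown_res τ)
  surjective := surjOn_blowDown_res τ
  birational := binomial_subset_closure_isoLocus τ
  small := codimAtLeastTwo_exceptionalLocus τ

end Charts

/-! ### Lifts of the permutations and of the involution to the resolutions -/

section Symmetries

theorem IsRegularIso.symm {ι κ ι' κ' : Type} [Fintype κ] [Fintype κ'] {X : Set (Amb ι κ)}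
    {Y : Set (Amb ι' κ')} {f : Amb ι κ → Amb ι' κ'} (hf : IsRegularIso f X Y) :
    ∃ g, IsRegularIso g Y X ∧ Set.InvOn g f X Y := by
  obtain ⟨hf1, g, hg, h⟩ := hf
  exact ⟨g, ⟨hg, f, hf1, h.symm⟩, h⟩

theorem isRegularIso_id {ι κ : Type} [Fintype κ] {X : Set (Amb ι κ)} : IsRegularIso id X X :=
  ⟨isRegularMap_id, id, isRegularMap_id, fun _ _ => rfl, fun _ _ => rfl⟩

/-- The image of a point of the projective line under `[a : b] ↦ [b : a]`. -/
def P1.swap (p : P1) : P1 := pt (p.rep 1) (p.rep 0)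

/-- The image of a point of the projective line under `[a : b] ↦ [-a : b]`. -/
def P1.neg (p : P1) : P1 := pt (-p.rep 0) (p.rep 1)

theorem P1.exists_rep_swap (p : P1) :
    ∃ c : ℂ, c ≠ 0 ∧ p.swap.rep 0 = c * p.rep 1 ∧ p.swap.rep 1 = c * p.rep 0 :=
  exists_rep_pt p.rep_ne.symm

theorem P1.exists_rep_neg (p : P1) :
    ∃ c : ℂ, c ≠ 0 ∧ p.neg.rep 0 = c * -p.rep 0 ∧ p.neg.rep 1 = c * p.rep 1 :=
  exists_rep_pt (p.rep_ne.imp_left neg_ne_zero.2)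

theorem Amb.exists_rep_swap {ι κ : Type} (z : Amb ι κ) (k : κ) :
    ∃ c : ℂ, c ≠ 0 ∧ (z.proj k).swap.rep 0 = c * z.si k ∧ (z.proj k).swap.rep 1 = c * z.al k :=
  (z.proj k).exists_rep_swap

theorem Amb.exists_rep_neg {ι κ : Type} (z : Amb ι κ) (k : κ) :
    ∃ c : ℂ, c ≠ 0 ∧ (z.proj k).neg.rep 0 = c * -z.al k ∧ (z.proj k).neg.rep 1 = c * z.si k :=
  (z.proj k).exists_rep_neg

@[simp] theorem P1.swap_swap (p : P1) : p.swap.swap = p := by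
  obtain ⟨c, -, h0, h1⟩ := p.exists_rep_swap
  obtain ⟨c', -, h0', h1'⟩ := p.swap.exists_rep_swap
  refine P1.ext ?_
  rw [h0', h1', h0, h1]
  ring

@[simp] theorem P1.neg_neg (p : P1) : p.neg.neg = p := by
  obtain ⟨c, -, h0, h1⟩ := p.exists_rep_neg
  obtain ⟨c', -, h0', h1'⟩ := p.neg.exists_rep_neg
  refine P1.ext ?_
  rw [h0', h1', h0, h1]
  ring

variable {ι κ : Type} [Fintype κ] {X : Set (Amb ι κ)}

theorem IsRegularToP1.swap {f : Amb ι κ → P1} (hf : IsRegularToP1 X f) :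
    IsRegularToP1 X (fun z => (f z).swap) := by
  refine isRegularToP1_of_locally fun z hz => ?_
  obtain ⟨O, hO, hzO, G, hG, hfG⟩ := hf.exists_eq_mk hz
  have hne : ∀ z' ∈ X ∩ O, G z' 1 ≠ 0 ∨ G z' 0 ≠ 0 := by
    intro z' hz'
    obtain ⟨h0, -⟩ := hfG z' hz'
    by_contra! h
    exact h0 (funext (Fin.forall_fin_two.2 ⟨h.2, h.1⟩))
  refine ⟨O, hO, hzO, (isRegularToP1_pt (hG 1) (hG 0) hne).congr fun z' hz' => ?_⟩
  obtain ⟨h0, h1⟩ := hfG z' hz'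
  obtain ⟨a, ha⟩ := Projectivization.exists_smul_eq_mk_rep ℂ (G z') h0
  obtain ⟨c, -, c0, c1⟩ := (f z').exists_rep_swap
  refine (P1.eq_pt (hne z' hz') ?_).symm
  rw [c0, c1, h1, ← ha]
  simp only [Pi.smul_apply, Units.smul_def, smul_eq_mul]
  ring

theorem IsRegularToP1.neg {f : Amb ι κ → P1} (hf : IsRegularToP1 X f) :
    IsRegularToP1 X (fun z => (f z).neg) := by
  refine isRegularToP1_of_locally fun z hz => ?_
  obtain ⟨O, hO, hzO, G, hG, hfG⟩ := hf.exists_eq_mk hz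
  have hne : ∀ z' ∈ X ∩ O, -G z' 0 ≠ 0 ∨ G z' 1 ≠ 0 := by
    intro z' hz'
    obtain ⟨h0, -⟩ := hfG z' hz'
    by_contra! h
    exact h0 (funext (Fin.forall_fin_two.2 ⟨neg_eq_zero.1 h.1, h.2⟩))
  refine ⟨O, hO, hzO, (isRegularToP1_pt (hG 0).neg (hG 1) hne).congr fun z' hz' => ?_⟩
  obtain ⟨h0, h1⟩ := hfG z' hz'
  obtain ⟨a, ha⟩ := Projectivization.exists_smul_eq_mk_rep ℂ (G z') h0
  obtain ⟨c, -, c0, c1⟩ := (f z').exists_rep_neg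
  refine (P1.eq_pt (hne z' hz') ?_).symm
  rw [c0, c1, h1, ← ha]
  simp only [Pi.smul_apply, Units.smul_def, smul_eq_mul]
  ring

/-- The lift of a permutation of `(x, w, t)` to `𝔸⁵ × ℙ¹ × ℙ¹`. -/
def permLift (π : Equiv.Perm (Fin 3)) (z : Amb Coord (Fin 2)) : Amb Coord (Fin 2) :=
  ⟨Sum.elim (fun m => z.u (π⁻¹ m)) (fun k => z.aff (Sum.inr k)), z.proj⟩

/-- The lift of the involution to `𝔸⁵ × ℙ¹ × ℙ¹`. -/
def invLift (z : Amb Coord (Fin 2)) : Amb Coord (Fin 2) :=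
  ⟨Sum.elim z.u ![-z.s, -z.y], ![(z.proj 1).neg, (z.proj 0).neg]⟩

theorem isRegularMap_permLift (π τ : Equiv.Perm (Fin 3)) :
    IsRegularMap (permLift π) (res τ) (res (π * τ)) := by
  refine ⟨?_, ?_, fun k => isRegularToP1_proj k⟩
  · rintro z ⟨h1, h2, h3⟩
    refine ⟨?_, ?_, ?_⟩
    · change z.u (π⁻¹ (π (τ 0))) * z.al 0 = z.si 0 * z.y
      simpa using h1
    · change z.u (π⁻¹ (π (τ 1))) * z.al 1 = z.si 1 * z.s
      simpa using h2
    · change z.al 0 * z.al 1 = z.si 0 * z.si 1 * z.u (π⁻¹ (π (τ 2)))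
      simpa using h3
  · rintro (m | k)
    · exact isRegularFunction_aff _
    · exact isRegularFunction_aff _

theorem permLift_permLift (π π' : Equiv.Perm (Fin 3)) (h : π * π' = 1) (z : Amb Coord (Fin 2)) :
    permLift π (permLift π' z) = z := by
  ext1
  · funext j
    rcases j with m | k
    · change z.u (π'⁻¹ (π⁻¹ m)) = z.u m
      rw [← Equiv.Perm.mul_apply, ← mul_inv_rev, h]
      simp
    · rfl
  · rfl

theorem isRegularIso_permLift (π τ : Equiv.Perm (Fin 3)) :
    IsRegularIso (permLift π) (res τ) (res (π * τ)) := by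
  refine ⟨isRegularMap_permLift π τ, permLift π⁻¹, ?_,
    fun z _ => permLift_permLift _ _ (by simp) z, fun z _ => permLift_permLift _ _ (by simp) z⟩
  have h := isRegularMap_permLift π⁻¹ (π * τ)
  rwa [inv_mul_cancel_left] at h

theorem carries_permAct (π τ : Equiv.Perm (Fin 3)) : Carries (permAct π) τ (π * τ) := by
  refine ⟨permLift π, isRegularIso_permLift π τ, ?_⟩
  rintro z - ⟨b, hb⟩ rfl
  exact Amb.ext rfl (Subsingleton.elim _ _)

/-- Exchanging the two lines interchanges the first two equations with `i` and `j` exchanged. The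
sign on each `α` matches the sign of `-s` or `-y`, and the two signs cancel in the third equation.
-/
theorem isRegularMap_invLift (τ : Equiv.Perm (Fin 3)) :
    IsRegularMap invLift (res τ) (res (τ * Equiv.swap 0 1)) := by
  refine ⟨?_, ?_, Fin.forall_fin_two.2 ⟨(isRegularToP1_proj 1).neg, (isRegularToP1_proj 0).neg⟩⟩
  · rintro z ⟨h1, h2, h3⟩
    obtain ⟨c, -, c0, c1⟩ := z.exists_rep_neg 0
    obtain ⟨d, -, d0, d1⟩ := z.exists_rep_neg 1
    have e2 : Equiv.swap (0 : Fin 3) 1 2 = 2 := by decide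
    refine ⟨?_, ?_, ?_⟩
    · change z.u (τ (Equiv.swap 0 1 0)) * (P1.neg _).rep 0 = (P1.neg _).rep 1 * -z.s
      rw [d0, d1, Equiv.swap_apply_left]
      linear_combination (-d) * h2
    · change z.u (τ (Equiv.swap 0 1 1)) * (P1.neg _).rep 0 = (P1.neg _).rep 1 * -z.y
      rw [c0, c1, Equiv.swap_apply_right]
      linear_combination (-c) * h1
    · change (P1.neg _).rep 0 * (P1.neg _).rep 0
        = (P1.neg _).rep 1 * (P1.neg _).rep 1 * z.u (τ (Equiv.swap 0 1 2))
      rw [c0, c1, d0, d1, e2]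
      linear_combination (c * d) * h3
  · rintro (m | k)
    · exact isRegularFunction_aff _
    · fin_cases k
      · exact (isRegularFunction_aff (Sum.inr 1)).neg
      · exact (isRegularFunction_aff (Sum.inr 0)).neg

theorem invLift_invLift (z : Amb Coord (Fin 2)) : invLift (invLift z) = z := by
  ext1
  · funext j
    rcases j with m | k
    · rfl
    · fin_cases k <;> simp [invLift, Amb.y, Amb.s]
  · funext k
    fin_cases k <;> simp [invLift]

theorem isRegularIso_invLift (τ : Equiv.Perm (Fin 3)) :
    IsRegularIso invLift (res τ) (res (τ * Equiv.swap 0 1)) := by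
  refine ⟨isRegularMap_invLift τ, invLift, ?_, fun z _ => invLift_invLift z,
    fun z _ => invLift_invLift z⟩
  have h := isRegularMap_invLift (τ * Equiv.swap 0 1)
  rwa [Equiv.mul_swap_mul_self] at h

theorem blowDown_invLift (z : Amb Coord (Fin 2)) : blowDown (invLift z) = invPoint (blowDown z) :=
  Amb.ext rfl (Subsingleton.elim _ _)

theorem carries_ellInv (τ : Equiv.Perm (Fin 3)) : Carries ellInv τ (τ * Equiv.swap 0 1) := by
  refine ⟨invLift, isRegularIso_invLift τ, ?_⟩
  rintro z - ⟨b, hb⟩ rfl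
  exact blowDown_invLift z

theorem Carries.mul {g g' : Equiv.Perm binomial} {τ τ' τ'' : Equiv.Perm (Fin 3)}
    (h' : Carries g' τ' τ'') (h : Carries g τ τ') : Carries (g' * g) τ τ'' := by
  obtain ⟨φ, hφ, hb⟩ := h
  obtain ⟨φ', hφ', hb'⟩ := h'
  exact ⟨φ' ∘ φ, hφ'.comp hφ, fun z hz b hbz =>
    hb' (φ z) (hφ.1.1 hz) (g b) (hb z hz b hbz).symm⟩

theorem Carries.inv {g : Equiv.Perm binomial} {τ τ' : Equiv.Perm (Fin 3)}
    (h : Carries g τ τ') : Carries g⁻¹ τ' τ := by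
  obtain ⟨φ, hφ, hb⟩ := h
  obtain ⟨ψ, hψ, hinv⟩ := hφ.symm
  refine ⟨ψ, hψ, fun z hz b hbz => ?_⟩
  have hψz : ψ z ∈ res τ := hψ.1.1 hz
  have h1 := hb (ψ z) hψz ⟨_, mapsTo_blowDown_res τ hψz⟩ rfl
  rw [hinv.2 hz, ← hbz] at h1
  exact congrArg Subtype.val (g.symm_apply_eq.2 (Subtype.ext h1)).symm

theorem carries_one (τ : Equiv.Perm (Fin 3)) : Carries 1 τ τ :=
  ⟨id, isRegularIso_id, fun _ _ _ hb => hb.symm⟩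

/-- The bijection `g` of the binomial variety is an automorphism. -/
def IsAutomorphism (g : Equiv.Perm binomial) : Prop :=
  ∃ φ, IsRegularIso φ binomial binomial ∧ ∀ b : binomial, φ b.1 = (g b).1

theorem isRegularMap_permPoint (π : Equiv.Perm (Fin 3)) :
    IsRegularMap (permPoint π) binomial binomial := by
  refine ⟨fun p hp => permPoint_mem π hp, ?_, fun k => k.elim0⟩
  rintro (m | k)
  · exact isRegularFunction_aff _
  · exact isRegularFunction_aff _

theorem isRegularMap_invPoint : IsRegularMap invPoint binomial binomial := by
  refine ⟨fun p hp => invPoint_mem hp, ?_, fun k => k.elim0⟩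
  rintro (m | k)
  · exact isRegularFunction_aff _
  · fin_cases k
    · exact (isRegularFunction_aff (Sum.inr 1)).neg
    · exact (isRegularFunction_aff (Sum.inr 0)).neg

theorem isAutomorphism_permAct (π : Equiv.Perm (Fin 3)) : IsAutomorphism (permAct π) := by
  refine ⟨permPoint π, ⟨isRegularMap_permPoint π, permPoint π⁻¹, isRegularMap_permPoint π⁻¹,
    fun p _ => ?_, fun p _ => ?_⟩, fun b => rfl⟩
  · rw [← permPoint_mul, inv_mul_cancel, permPoint_one]
  · rw [← permPoint_mul, mul_inv_cancel, permPoint_one]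

theorem isAutomorphism_ellInv : IsAutomorphism ellInv :=
  ⟨invPoint, ⟨isRegularMap_invPoint, invPoint, isRegularMap_invPoint,
    fun p _ => invPoint_invPoint p, fun p _ => invPoint_invPoint p⟩, fun _ => rfl⟩

theorem IsAutomorphism.mul {g g' : Equiv.Perm binomial} (h' : IsAutomorphism g')
    (h : IsAutomorphism g) : IsAutomorphism (g' * g) := by
  obtain ⟨φ, hφ, hb⟩ := h
  obtain ⟨φ', hφ', hb'⟩ := h'
  exact ⟨φ' ∘ φ, hφ'.comp hφ, fun b => by
    rw [Function.comp_apply, hb, hb', Equiv.Perm.mul_apply]⟩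

theorem IsAutomorphism.inv {g : Equiv.Perm binomial} (h : IsAutomorphism g) :
    IsAutomorphism g⁻¹ := by
  obtain ⟨φ, hφ, hb⟩ := h
  obtain ⟨ψ, hψ, hinv⟩ := hφ.symm
  refine ⟨ψ, hψ, fun b => ?_⟩
  have h1 := hb (g⁻¹ b)
  rw [show g (g⁻¹ b) = b from g.apply_symm_apply b] at h1
  rw [← h1]
  exact hinv.1 (g⁻¹ b).2

end Symmetries

/-! ### Rigidity: the resolutions are pairwise non-isomorphic over the base -/

section Rigidity

/-- A neighbourhood of a point meets every coordinate line through the point in a further point. -/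
theorem exists_update_mem {ι κ : Type} [Fintype κ] {n : ℕ} {ψ : Amb (Fin n) (Fin 0) → Amb ι κ}
    (hψ : ContinuousOn ψ Set.univ) {O : Set (Amb ι κ)} (hO : IsOpen O) (p : Fin n → ℂ) (m : Fin n)
    (hm : p m = 0) (hp : ψ ⟨p, Fin.elim0⟩ ∈ O) :
    ∃ c : ℂ, c ≠ 0 ∧ ψ ⟨Function.update p m c, Fin.elim0⟩ ∈ O := by
  let L : Amb (Fin 1) (Fin 0) → Amb (Fin n) (Fin 0) :=
    fun c => ⟨Function.update p m (c.aff 0), Fin.elim0⟩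
  have hL : IsRegularMap L Set.univ Set.univ := by
    refine ⟨Set.mapsTo_univ _ _, fun i => ?_, fun k => k.elim0⟩
    by_cases hi : i = m
    · subst hi
      simpa [L] using isRegularFunction_aff 0
    · simpa [L, hi] using isRegularFunction_const (p i)
  have hψL : Continuous (ψ ∘ L) :=
    (continuousOn_univ.1 hψ).comp (continuousOn_univ.1 hL.continuousOn)
  -- In the irreducible affine line, the non-empty open preimage of `O` meets the open set `c ≠ 0`.
  obtain ⟨c, -, h1, h2⟩ := isIrreducible_univ_affineSpace.2 _ _ (hO.preimage hψL)
    (isOpen_aff_ne (ι := Fin 1) (κ := Fin 0) 0)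
    ⟨⟨fun _ => 0, Fin.elim0⟩, trivial, by simpa [L, ← hm] using hp⟩
    ⟨⟨fun _ => 1, Fin.elim0⟩, trivial, by simp⟩
  exact ⟨c.aff 0, h2, h1⟩

/-- The conditions `α = 0` and `σ = 0` are closed. Holding along two punctured axes through `p`,
both would hold at `p`, but `α` and `σ` have no common zero. -/
theorem false_of_limits {ι κ : Type} [Fintype κ] {n : ℕ} {ψ : Amb (Fin n) (Fin 0) → Amb ι κ}
    (hψ : ContinuousOn ψ Set.univ) (k : κ) (p : Fin n → ℂ) (m m' : Fin n) (hm : p m = 0)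
    (hm' : p m' = 0)
    (h : ∀ c : ℂ, c ≠ 0 → (ψ ⟨Function.update p m c, Fin.elim0⟩).al k = 0)
    (h' : ∀ c : ℂ, c ≠ 0 → (ψ ⟨Function.update p m' c, Fin.elim0⟩).si k = 0) : False := by
  rcases al_ne_or_si_ne (ψ ⟨p, Fin.elim0⟩) k with h0 | h0
  · obtain ⟨c, hc, hc'⟩ := exists_update_mem hψ (isOpen_al_ne k) p m hm h0
    exact hc' (h c hc)
  · obtain ⟨c, hc, hc'⟩ := exists_update_mem hψ (isOpen_si_ne k) p m' hm' h0
    exact hc' (h' c hc)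

/-- In the middle chart `y = v₀v₂`, `s = v₁v₃` and `(u_i, u_j, u_k) = (v₀, v₁, v₂v₃)`. An
isomorphism over the base preserves these functions, so the image satisfies `u_{i'} α₊ = σ₊ v₀v₂`
and `u_{j'} α₋ = σ₋ v₁v₃`. Unless `i' = i` and `j' = j`, one of these prescribes incompatible
limits. -/
theorem eq_of_carries_one {τ τ' : Equiv.Perm (Fin 3)} (h : Carries 1 τ τ') : τ = τ' := by
  obtain ⟨φ, hφ, hb⟩ := h
  have hψ : ContinuousOn (φ ∘ chart τ 1) Set.univ :=
    (hφ.1.comp ((isRegularMap_chart τ 1).mono subset_rfl fun v _ =>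
      (chart_mem τ 1 v).1)).continuousOn
  have haff : ∀ v, (φ (chart τ 1 v)).aff = (chart τ 1 v).aff := by
    intro v
    have hv := (chart_mem τ 1 v).1
    exact congrArg (fun p : Amb Coord (Fin 0) => p.aff)
      (hb _ hv ⟨_, mapsTo_blowDown_res τ hv⟩ rfl)
  have hmem : ∀ v, φ (chart τ 1 v) ∈ res τ' := fun v => hφ.1.1 (chart_mem τ 1 v).1
  have hu : ∀ v m, (φ (chart τ 1 v)).u m = (chart τ 1 v).u m := fun v m =>
    congrFun (haff v) (Sum.inl m)
  have hy : ∀ v, (φ (chart τ 1 v)).y = v.aff 0 * v.aff 2 := fun v =>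
    congrFun (haff v) (Sum.inr 0)
  have hs : ∀ v, (φ (chart τ 1 v)).s = v.aff 1 * v.aff 3 := fun v =>
    congrFun (haff v) (Sum.inr 1)
  have hu0 : ∀ v, (chart τ 1 v).u (τ 0) = v.aff 0 := fun v => by
    simp [chart, Amb.u, affCoord_inl]
  have hu1 : ∀ v, (chart τ 1 v).u (τ 1) = v.aff 1 := fun v => by
    simp [chart, Amb.u, affCoord_inl]
  have hu2 : ∀ v, (chart τ 1 v).u (τ 2) = v.aff 2 * v.aff 3 := fun v => by
    simp [chart, Amb.u, affCoord_inl]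
  have key0 : ∀ n : Fin 3, τ' 0 = τ n → n = 0 := by
    intro n hn
    have e : ∀ v, (chart τ 1 v).u (τ n) * (φ (chart τ 1 v)).al 0
        = (φ (chart τ 1 v)).si 0 * (v.aff 0 * v.aff 2) := by
      intro v
      rw [← hy, ← hu, ← hn]
      exact (hmem v).1
    fin_cases n
    · rfl
    -- The equation is `v₁ α₊ = σ₊ v₀v₂`. With `v₂ = 1`, moving along the `v₁`-axis forces `α₊ = 0`
    -- and moving along the `v₀`-axis forces `σ₊ = 0`.
    · refine (false_of_limits hψ 0 ![0, 0, 1, 0] 1 0 rfl rfl (fun c hc => ?_) fun c hc => ?_).elim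
      · simpa [hu1, hc] using e ⟨Function.update ![0, 0, 1, 0] 1 c, Fin.elim0⟩
      · simpa [hu1, hc] using e ⟨Function.update ![0, 0, 1, 0] 0 c, Fin.elim0⟩
    -- Now the equation is `v₂v₃ α₊ = σ₊ v₀v₂`, and the `v₃`-axis plays the role of the `v₁`-axis.
    · refine (false_of_limits hψ 0 ![0, 0, 1, 0] 3 0 rfl rfl (fun c hc => ?_) fun c hc => ?_).elim
      · simpa [hu2, hc] using e ⟨Function.update ![0, 0, 1, 0] 3 c, Fin.elim0⟩
      · simpa [hu2, hc] using e ⟨Function.update ![0, 0, 1, 0] 0 c, Fin.elim0⟩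
  have key1 : ∀ n : Fin 3, τ' 1 = τ n → n = 1 := by
    intro n hn
    have e : ∀ v, (chart τ 1 v).u (τ n) * (φ (chart τ 1 v)).al 1
        = (φ (chart τ 1 v)).si 1 * (v.aff 1 * v.aff 3) := by
      intro v
      rw [← hs, ← hu, ← hn]
      exact (hmem v).2.1
    fin_cases n
    · refine (false_of_limits hψ 1 ![0, 0, 0, 1] 0 1 rfl rfl (fun c hc => ?_) fun c hc => ?_).elim
      · simpa [hu0, hc] using e ⟨Function.update ![0, 0, 0, 1] 0 c, Fin.elim0⟩
      · simpa [hu0, hc] using e ⟨Function.update ![0, 0, 0, 1] 1 c, Fin.elim0⟩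
    · rfl
    · refine (false_of_limits hψ 1 ![0, 0, 0, 1] 2 1 rfl rfl (fun c hc => ?_) fun c hc => ?_).elim
      · simpa [hu2, hc] using e ⟨Function.update ![0, 0, 0, 1] 2 c, Fin.elim0⟩
      · simpa [hu2, hc] using e ⟨Function.update ![0, 0, 0, 1] 1 c, Fin.elim0⟩
  obtain ⟨n, hn⟩ := τ.surjective (τ' 0)
  obtain ⟨n', hn'⟩ := τ.surjective (τ' 1)
  obtain rfl := key0 n hn.symm
  obtain rfl := key1 n' hn'.symm
  -- A permutation of three indices is determined by two of its values.
  revert hn hn'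
  clear * -
  revert τ τ'
  decide

theorem Carries.unique {g : Equiv.Perm binomial} {τ τ' τ'' : Equiv.Perm (Fin 3)}
    (h : Carries g τ τ') (h' : Carries g τ τ'') : τ' = τ'' := by
  have h1 := h'.mul h.inv
  rw [mul_inv_cancel] at h1
  exact eq_of_carries_one h1

end Rigidity

/-! ### Conifold flops through a common partial resolution -/

section Flops

variable (τ : Equiv.Perm (Fin 3))

/-- The partial resolution `u_i α₊ = σ₊ y`, `α₊ s = σ₊ u_j u_k` in `𝔸⁵ × ℙ¹`. -/
def partialRes : Set (Amb Coord (Fin 1)) :=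
  {z | z.u (τ 0) * z.al 0 = z.si 0 * z.y ∧ z.al 0 * z.s = z.si 0 * (z.u (τ 1) * z.u (τ 2))}

/-- Forgetting the second projective line. -/
def forget (z : Amb Coord (Fin 2)) : Amb Coord (Fin 1) := ⟨z.aff, fun _ => z.proj 0⟩

/-- The defining equations are symmetric in `j` and `k`, so ℰ_ij and ℰ_ik contract to the same
variety. -/
theorem partialRes_mul_swap : partialRes (τ * Equiv.swap 1 2) = partialRes τ := by
  have e0 : Equiv.swap (1 : Fin 3) 2 0 = 0 := by decide
  simp [partialRes, e0, mul_comm]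

theorem forget_mem {z : Amb Coord (Fin 2)} (hz : z ∈ res τ) : forget z ∈ partialRes τ := by
  obtain ⟨h1, h2, h3⟩ := hz
  refine ⟨h1, ?_⟩
  change z.al 0 * z.s = z.si 0 * (z.u (τ 1) * z.u (τ 2))
  rcases al_ne_or_si_ne z 1 with h | h <;> refine mul_left_cancel₀ h ?_
  · linear_combination z.s * h3 - z.si 0 * z.u (τ 2) * h2
  · linear_combination z.u (τ 1) * h3 - z.al 0 * h2

theorem isRegularMap_forget {X : Set (Amb Coord (Fin 2))} {Y : Set (Amb Coord (Fin 1))}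
    (h : Set.MapsTo forget X Y) : IsRegularMap forget X Y :=
  ⟨h, fun i => isRegularFunction_aff i, fun _ => isRegularToP1_proj 0⟩

theorem mapsTo_blowDown_partialRes : Set.MapsTo blowDown (partialRes τ) binomial := by
  rintro z ⟨h1, h2⟩
  change z.y * z.s = z.u 0 * z.u 1 * z.u 2
  rw [prod_u τ]
  rcases al_ne_or_si_ne z 0 with h | h <;> refine mul_left_cancel₀ h ?_
  · linear_combination z.y * h2 - z.u (τ 1) * z.u (τ 2) * h1
  · linear_combination z.u (τ 0) * h2 - z.s * h1

/-- Where `α₊ ≠ 0`, the third equation determines the forgotten coordinate: `[α₋ : σ₋] = [σ₊ u_k :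
α₊]`. -/
theorem isRegularIso_forget :
    IsRegularIso forget (res τ ∩ forget ⁻¹' {z | z.al 0 ≠ 0})
      (partialRes τ ∩ {z | z.al 0 ≠ 0}) := by
  refine ⟨isRegularMap_forget fun z hz => ⟨forget_mem τ hz.1, hz.2⟩,
    fun z => ⟨z.aff, ![z.proj 0, pt (z.si 0 / z.al 0 * z.u (τ 2)) 1]⟩, ⟨?_,
      fun i => isRegularFunction_aff i, Fin.forall_fin_two.2 ⟨isRegularToP1_proj 0, ?_⟩⟩, ?_, ?_⟩
  · rintro z ⟨⟨h1, h2⟩, h0⟩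
    obtain ⟨c, -, c0, c1⟩ :=
      exists_rep_pt (a := z.si 0 / z.al 0 * z.u (τ 2)) (b := 1) (Or.inr one_ne_zero)
    have h0' : z.al 0 ≠ 0 := h0
    refine ⟨⟨h1, ?_, ?_⟩, h0⟩
    · change z.u (τ 1) * (pt _ _).rep 0 = (pt _ _).rep 1 * z.s
      rw [c0, c1]
      field_simp
      linear_combination -c * h2
    · change z.al 0 * (pt _ _).rep 0 = z.si 0 * (pt _ _).rep 1 * z.u (τ 2)
      rw [c0, c1]
      field_simp
  · exact isRegularToP1_pt ((isRegularFunction_rep_div 0 1 0 fun z hz => hz.2).mul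
      (isRegularFunction_aff _)) (isRegularFunction_const 1) fun _ _ => Or.inr one_ne_zero
  · rintro z ⟨⟨h1, h2, h3⟩, h0⟩
    have h0' : z.al 0 ≠ 0 := h0
    symm
    ext1
    · rfl
    · funext k
      fin_cases k
      · rfl
      · refine P1.eq_pt (Or.inr one_ne_zero) ?_
        change z.al 1 * 1 = z.si 1 * (z.si 0 / z.al 0 * z.u (τ 2))
        field_simp
        linear_combination h3
  · rintro z -
    ext1
    · rfl
    · funext k
      fin_cases k
      rfl

/-- The coordinates `(u₁, u₂, v₁, v₂, l) = (u_j, u_k, s, α₊/σ₊, u_i)` of the product of the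
conifold and a line. -/
def conifoldCoord {κ : Type} (k : κ) (z : Amb Coord κ) : Fin 5 → ℂ :=
  ![z.u (τ 1), z.u (τ 2), z.s, z.al k / z.si k, z.u (τ 0)]

/-- The affine coordinates of a point of the partial resolution in terms of `conifoldCoord`. -/
def ofConifold (v : Fin 5 → ℂ) : Coord → ℂ := affCoord τ (v 4) (v 0) (v 1) (v 4 * v 3) (v 2)

theorem isRegularFunction_conifoldCoord {κ : Type} [Fintype κ] {X : Set (Amb Coord κ)} (k : κ)
    (h : ∀ z ∈ X, z.si k ≠ 0) (i : Fin 5) :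
    IsRegularFunction X (fun z => conifoldCoord τ k z i) := by
  fin_cases i
  · exact isRegularFunction_aff _
  · exact isRegularFunction_aff _
  · exact isRegularFunction_aff _
  · exact isRegularFunction_rep_div k 0 1 h
  · exact isRegularFunction_aff _

theorem isRegularFunction_ofConifold {κ : Type} [Fintype κ] {X : Set (Amb (Fin 5) κ)} (i : Coord) :
    IsRegularFunction X (fun z => ofConifold τ z.aff i) :=
  isRegularFunction_affCoord τ (isRegularFunction_aff 4) (isRegularFunction_aff 0)
    (isRegularFunction_aff 1) ((isRegularFunction_aff 4).mul (isRegularFunction_aff 3))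
    (isRegularFunction_aff 2) i

theorem ofConifold_conifoldCoord {κ : Type} (k : κ) {z : Amb Coord κ} (hk : z.si k ≠ 0)
    (h : z.u (τ 0) * z.al k = z.si k * z.y) : ofConifold τ (conifoldCoord τ k z) = z.aff := by
  refine (eq_affCoord rfl rfl rfl ?_ rfl).symm
  change z.y = z.u (τ 0) * (z.al k / z.si k)
  field_simp
  linear_combination -h

theorem conifoldCoord_ofConifold {κ : Type} (k : κ) (v : Fin 5 → ℂ) (P : κ → P1)
    (hP : P k = pt (v 3) 1) : conifoldCoord τ k ⟨ofConifold τ v, P⟩ = v := by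
  funext i
  fin_cases i <;>
    simp [conifoldCoord, ofConifold, Amb.u, Amb.s, Amb.al, Amb.si, affCoord_inl, affCoord_inr, hP,
      P1.rep_pt_div]

theorem u_ofConifold {κ : Type} (v : Fin 5 → ℂ) (P : κ → P1) (n : Fin 3) :
    (⟨ofConifold τ v, P⟩ : Amb Coord κ).u (τ n) = ![v 4, v 0, v 1] n := by
  simp [ofConifold, Amb.u, affCoord_inl]

/-- With `a = α₊/σ₊`, the first equation eliminates `y = u_i a` and the second becomes `u_j u_k = s
a`; the free coordinate `u_i` is the line factor. -/
theorem isRegularIso_conifoldCoord :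
    IsRegularIso (fun z : Amb Coord (Fin 1) => (⟨conifoldCoord τ 0 z, Fin.elim0⟩ : Amb _ (Fin 0)))
      (partialRes τ ∩ {z | z.si 0 ≠ 0}) conifoldLine := by
  refine ⟨⟨?_, isRegularFunction_conifoldCoord τ 0 fun z hz => hz.2, fun k => k.elim0⟩,
    fun v => ⟨ofConifold τ v.aff, fun _ => pt (v.aff 3) 1⟩,
    ⟨?_, isRegularFunction_ofConifold τ, fun k => isRegularToP1_pt (isRegularFunction_aff 3)
      (isRegularFunction_const 1) fun _ _ => Or.inr one_ne_zero⟩, ?_, ?_⟩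
  · rintro z ⟨⟨h1, h2⟩, h0⟩
    have h0' : z.si 0 ≠ 0 := h0
    change z.u (τ 1) * z.u (τ 2) = z.s * (z.al 0 / z.si 0)
    field_simp
    linear_combination -h2
  · intro v hv
    have hv' : v.aff 0 * v.aff 1 = v.aff 2 * v.aff 3 := hv
    obtain ⟨c, hc, c0, c1⟩ := exists_rep_pt (a := v.aff 3) (b := 1) (Or.inr one_ne_zero)
    refine ⟨⟨?_, ?_⟩, P1.rep_pt_right_ne one_ne_zero⟩
    · rw [u_ofConifold]
      change v.aff 4 * (pt _ _).rep 0 = (pt _ _).rep 1 * (v.aff 4 * v.aff 3)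
      rw [c0, c1]
      ring
    · rw [u_ofConifold, u_ofConifold]
      change (pt _ _).rep 0 * v.aff 2 = (pt _ _).rep 1 * (v.aff 0 * v.aff 1)
      rw [c0, c1, hv']
      ring
  · rintro z ⟨⟨h1, h2⟩, h0⟩
    have h0' : z.si 0 ≠ 0 := h0
    ext1
    · exact ofConifold_conifoldCoord τ 0 h0 h1
    · funext k
      fin_cases k
      refine (P1.eq_pt (Or.inr one_ne_zero) ?_).symm
      change z.al 0 * 1 = z.si 0 * (z.al 0 / z.si 0)
      field_simp
  · intro v hv
    exact Amb.ext (conifoldCoord_ofConifold τ 0 _ _ rfl) (Subsingleton.elim _ _)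

/-- After eliminating `y`, the equations left are `u_j α₋ = σ₋ s` and `a α₋ = σ₋ u_k`. -/
theorem isRegularIso_conifoldRes₁ :
    IsRegularIso (fun z : Amb Coord (Fin 2) =>
        (⟨conifoldCoord τ 0 z, fun _ => z.proj 1⟩ : Amb _ (Fin 1)))
      (res τ ∩ forget ⁻¹' {z | z.si 0 ≠ 0}) conifoldRes₁ := by
  refine ⟨⟨?_, isRegularFunction_conifoldCoord τ 0 fun z hz => hz.2,
      fun _ => isRegularToP1_proj 1⟩,
    fun v => ⟨ofConifold τ v.aff, ![pt (v.aff 3) 1, v.proj 0]⟩,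
    ⟨?_, isRegularFunction_ofConifold τ, Fin.forall_fin_two.2
      ⟨isRegularToP1_pt (isRegularFunction_aff 3) (isRegularFunction_const 1)
        fun _ _ => Or.inr one_ne_zero, isRegularToP1_proj 0⟩⟩, ?_, ?_⟩
  · rintro z ⟨⟨h1, h2, h3⟩, h0⟩
    have h0' : z.si 0 ≠ 0 := h0
    refine ⟨h2, ?_⟩
    change z.al 0 / z.si 0 * z.al 1 = z.si 1 * z.u (τ 2)
    field_simp
    linear_combination h3
  · rintro v ⟨hv1, hv2⟩
    obtain ⟨c, hc, c0, c1⟩ := exists_rep_pt (a := v.aff 3) (b := 1) (Or.inr one_ne_zero)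
    refine ⟨⟨?_, ?_, ?_⟩, P1.rep_pt_right_ne one_ne_zero⟩
    · rw [u_ofConifold]
      change v.aff 4 * (pt _ _).rep 0 = (pt _ _).rep 1 * (v.aff 4 * v.aff 3)
      rw [c0, c1]
      ring
    · rw [u_ofConifold]
      exact hv1
    · rw [u_ofConifold]
      change (pt _ _).rep 0 * v.al 0 = (pt _ _).rep 1 * v.si 0 * v.aff 1
      rw [c0, c1]
      linear_combination c * hv2
  · rintro z ⟨⟨h1, h2, h3⟩, h0⟩
    have h0' : z.si 0 ≠ 0 := h0
    ext1
    · exact ofConifold_conifoldCoord τ 0 h0 h1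
    · funext k
      fin_cases k
      · refine (P1.eq_pt (Or.inr one_ne_zero) ?_).symm
        change z.al 0 * 1 = z.si 0 * (z.al 0 / z.si 0)
        field_simp
      · rfl
  · intro v hv
    refine Amb.ext (conifoldCoord_ofConifold τ 0 _ _ rfl) ?_
    funext k
    fin_cases k
    rfl

/-- For ℰ_ik the equations left are `u_k α₋ = σ₋ s` and `a α₋ = σ₋ u_j`. They take the form of the
second small resolution only after `α₋` and `σ₋` are exchanged, whence `P1.swap`. -/
theorem isRegularIso_conifoldRes₂ :
    IsRegularIso (fun z : Amb Coord (Fin 2) =>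
        (⟨conifoldCoord τ 0 z, fun _ => (z.proj 1).swap⟩ : Amb _ (Fin 1)))
      (res (τ * Equiv.swap 1 2) ∩ forget ⁻¹' {z | z.si 0 ≠ 0}) conifoldRes₂ := by
  have e0 : (τ * Equiv.swap 1 2 : Equiv.Perm (Fin 3)) 0 = τ 0 := congrArg τ (by decide)
  have e1 : (τ * Equiv.swap 1 2 : Equiv.Perm (Fin 3)) 1 = τ 2 := congrArg τ (by decide)
  have e2 : (τ * Equiv.swap 1 2 : Equiv.Perm (Fin 3)) 2 = τ 1 := congrArg τ (by decide)
  simp only [res, e0, e1, e2]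
  refine ⟨⟨?_, isRegularFunction_conifoldCoord τ 0 fun z hz => hz.2,
      fun _ => (isRegularToP1_proj 1).swap⟩,
    fun v => ⟨ofConifold τ v.aff, ![pt (v.aff 3) 1, (v.proj 0).swap]⟩,
    ⟨?_, isRegularFunction_ofConifold τ, Fin.forall_fin_two.2
      ⟨isRegularToP1_pt (isRegularFunction_aff 3) (isRegularFunction_const 1)
        fun _ _ => Or.inr one_ne_zero, (isRegularToP1_proj 0).swap⟩⟩, ?_, ?_⟩
  · rintro z ⟨⟨h1, h2, h3⟩, h0⟩
    have h0' : z.si 0 ≠ 0 := h0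
    obtain ⟨d, -, d0, d1⟩ := z.exists_rep_swap 1
    refine ⟨?_, ?_⟩
    · change z.u (τ 1) * (P1.swap _).rep 0 = (P1.swap _).rep 1 * (z.al 0 / z.si 0)
      rw [d0, d1]
      field_simp
      linear_combination -d * h3
    · change z.s * (P1.swap _).rep 0 = (P1.swap _).rep 1 * z.u (τ 2)
      rw [d0, d1]
      linear_combination -d * h2
  · rintro v ⟨hv1, hv2⟩
    obtain ⟨c, hc, c0, c1⟩ := exists_rep_pt (a := v.aff 3) (b := 1) (Or.inr one_ne_zero)
    obtain ⟨d, -, d0, d1⟩ := v.exists_rep_swap 0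
    refine ⟨⟨?_, ?_, ?_⟩, P1.rep_pt_right_ne one_ne_zero⟩
    · rw [u_ofConifold]
      change v.aff 4 * (pt _ _).rep 0 = (pt _ _).rep 1 * (v.aff 4 * v.aff 3)
      rw [c0, c1]
      ring
    · rw [u_ofConifold]
      change v.aff 1 * (P1.swap _).rep 0 = (P1.swap _).rep 1 * v.aff 2
      rw [d0, d1]
      linear_combination -d * hv2
    · rw [u_ofConifold]
      change (pt _ _).rep 0 * (P1.swap _).rep 0 = (pt _ _).rep 1 * (P1.swap _).rep 1 * v.aff 0
      rw [c0, c1, d0, d1]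
      linear_combination -c * d * hv1
  · rintro z ⟨⟨h1, h2, h3⟩, h0⟩
    have h0' : z.si 0 ≠ 0 := h0
    ext1
    · exact ofConifold_conifoldCoord τ 0 h0 h1
    · funext k
      fin_cases k
      · refine (P1.eq_pt (Or.inr one_ne_zero) ?_).symm
        change z.al 0 * 1 = z.si 0 * (z.al 0 / z.si 0)
        field_simp
      · exact P1.swap_swap _
  · intro v hv
    refine Amb.ext (conifoldCoord_ofConifold τ 0 _ _ rfl) ?_
    funext k
    fin_cases k
    exact P1.swap_swap _

theorem flopRel_mul_swap_one_two : FlopRel τ (τ * Equiv.swap 1 2) := by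
  have hZ := partialRes_mul_swap τ
  have hV := isRegularIso_forget (τ * Equiv.swap 1 2)
  have hf : Set.MapsTo forget (res (τ * Equiv.swap 1 2)) (partialRes τ) := fun z hz =>
    hZ ▸ forget_mem _ hz
  rw [hZ] at hV
  refine ⟨Coord, Fin 1, inferInstance, inferInstance, partialRes τ, forget, forget, blowDown,
    isRegularMap_forget fun z => forget_mem τ, isRegularMap_forget hf,
    isRegularMap_blowDown (mapsTo_blowDown_partialRes τ), fun _ _ => rfl, fun _ _ => rfl,
    {z | z.si 0 ≠ 0}, {z | z.al 0 ≠ 0}, isOpen_si_ne 0, isOpen_al_ne 0,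
    fun z _ => (al_ne_or_si_ne z 0).symm, isRegularIso_forget τ, hV, _, _, _,
    isRegularIso_conifoldCoord τ, isRegularIso_conifoldRes₁ τ, isRegularIso_conifoldRes₂ τ,
    fun _ _ => ?_, fun _ _ => ?_⟩ <;> exact Amb.ext rfl (Subsingleton.elim _ _)

/-- Conifold flops are preserved by an automorphism of the base that lifts to both sides. -/
theorem IsConifoldFlop.transfer {ι κ κ' κ₁ κ₁' : Type} [Fintype κ] [Fintype κ'] [Fintype κ₁]
    [Fintype κ₁'] {Y : Set (Amb ι (Fin 0))} {X : Set (Amb ι κ)} {X' : Set (Amb ι κ')}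
    {X₁ : Set (Amb ι κ₁)} {X₁' : Set (Amb ι κ₁')} (h : IsConifoldFlop Y X X')
    {φ : Amb ι κ₁ → Amb ι κ} {φ' : Amb ι κ₁' → Amb ι κ'} {γ : Amb ι (Fin 0) → Amb ι (Fin 0)}
    (hφ : IsRegularIso φ X₁ X) (hφ' : IsRegularIso φ' X₁' X') (hγ : IsRegularMap γ Y Y)
    (hb : ∀ z ∈ X₁, γ (blowDown (φ z)) = blowDown z)
    (hb' : ∀ z ∈ X₁', γ (blowDown (φ' z)) = blowDown z) : IsConifoldFlop Y X₁ X₁' := by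
  obtain ⟨ι₀, κ₀, _, _, Z, f, f', q, hf, hf', hq, hqf, hqf', U, V, hU, hV, hUV, hfV, hfV',
    e₀, e, e', he₀, he, he', hee, hee'⟩ := h
  refine ⟨ι₀, κ₀, inferInstance, inferInstance, Z, f ∘ φ, f' ∘ φ', γ ∘ q, hf.comp hφ.1,
    hf'.comp hφ'.1, hγ.comp hq, fun z hz => ?_, fun z hz => ?_, U, V, hU, hV, hUV,
    hfV.comp (hφ.restrict (f ⁻¹' V)), hfV'.comp (hφ'.restrict (f' ⁻¹' V)), e₀, e ∘ φ, e' ∘ φ', he₀,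
    he.comp (hφ.restrict (f ⁻¹' U)), he'.comp (hφ'.restrict (f' ⁻¹' U)),
    fun z hz => ?_, fun z hz => ?_⟩
  · simp only [Function.comp_apply]
    rw [hqf _ (hφ.1.1 hz), hb z hz]
  · simp only [Function.comp_apply]
    rw [hqf' _ (hφ'.1.1 hz), hb' z hz]
  · exact hee _ ⟨hφ.1.1 hz.1, hz.2⟩
  · exact hee' _ ⟨hφ'.1.1 hz.1, hz.2⟩

/-- Exchanging `i` and `k` is exchanging `j` and `k` conjugated by `swap 0 1`, and the involution
realises right multiplication by `swap 0 1` on both sides of the flop. -/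
theorem flopRel_mul_swap_zero_two : FlopRel τ (τ * Equiv.swap 0 2) := by
  have h := flopRel_mul_swap_one_two (τ * Equiv.swap 0 1)
  have hb : ∀ z : Amb Coord (Fin 2), invPoint (blowDown (invLift z)) = blowDown z := fun z => by
    rw [blowDown_invLift, invPoint_invPoint]
  have hφ := isRegularIso_invLift (τ * Equiv.swap 0 2)
  have e : τ * Equiv.swap 0 2 * Equiv.swap 0 1 = τ * Equiv.swap 0 1 * Equiv.swap 1 2 := by
    rw [mul_assoc, mul_assoc]
    exact congrArg (τ * ·) (by decide)
  rw [e] at hφ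
  exact IsConifoldFlop.transfer h (isRegularIso_invLift τ) hφ isRegularMap_invPoint
    (fun z _ => hb z) fun z _ => hb z

end Flops

/-! ### The hexagon of flops and its dihedral symmetry group -/

section Hexagon

/-- The hexagon of flops: the six permutations in cyclic order. -/
def hexagon : ZMod 6 → Equiv.Perm (Fin 3) := fun n =>
  (![1, Equiv.swap 1 2, Equiv.swap 1 2 * Equiv.swap 0 2, Equiv.swap 0 1,
    Equiv.swap 0 2 * Equiv.swap 1 2, Equiv.swap 0 2] : Fin 6 → Equiv.Perm (Fin 3)) n

theorem hexagon_add_one (n : ZMod 6) :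
    hexagon (n + 1) = hexagon n * Equiv.swap 1 2 ∨
      hexagon (n + 1) = hexagon n * Equiv.swap 0 2 := by
  revert n
  decide

theorem hexagon_bijective : Function.Bijective hexagon := by decide

/-- The hexagon as a bijection. -/
def hexagonEquiv : ZMod 6 ≃ Equiv.Perm (Fin 3) := Equiv.ofBijective hexagon hexagon_bijective

theorem flopRel_hexagon (n : ZMod 6) : FlopRel (hexagon n) (hexagon (n + 1)) := by
  rcases hexagon_add_one n with h | h <;> rw [h]
  · exact flopRel_mul_swap_one_two _
  · exact flopRel_mul_swap_zero_two _

theorem connected_flopRel : (SimpleGraph.fromRel FlopRel).Connected := by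
  have hr : ∀ n : ℕ, (SimpleGraph.fromRel FlopRel).Reachable (hexagon 0) (hexagon n) := by
    intro n
    induction n with
    | zero => simp
    | succ n ih =>
      refine ih.trans (SimpleGraph.Adj.reachable ?_)
      rw [SimpleGraph.fromRel_adj]
      refine ⟨fun h => ?_, Or.inl ?_⟩
      · have h1 := hexagon_bijective.1 h
        push_cast at h1
        exact absurd (left_eq_add.1 h1) (by decide)
      · push_cast
        exact flopRel_hexagon n
  have hr' : ∀ τ, (SimpleGraph.fromRel FlopRel).Reachable (hexagon 0) τ := by
    intro τ
    obtain ⟨m, rfl⟩ := hexagon_bijective.2 τ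
    simpa using hr m.val
  exact ⟨fun τ τ' => (hr' τ).symm.trans (hr' τ')⟩

/-- The permutation part of the transformation that realises a symmetry of the hexagon. -/
def dihedralPerm : DihedralGroup 6 → Equiv.Perm (Fin 3)
  -- Vertex `0` is the identity and must go to `hexagon c`, respectively `hexagon (-c)`. The power
  -- of `swap 0 1` undoes the right multiplication by the involution, which occurs with the same
  -- parity.
  | .r c => hexagon c * Equiv.swap 0 1 ^ c.val
  | .sr c => hexagon (-c) * Equiv.swap 0 1 ^ (c.val + 1)

/-- Whether the transformation that realises a symmetry of the hexagon involves the elliptic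
involution. -/
def dihedralFlip : DihedralGroup 6 → Bool
  -- The sides alternate between the two kinds of flops, and only the involution exchanges the
  -- kinds. The rotation by `c` does so for odd `c`; the reflection `n ↦ -c - n` sends the side
  -- starting at `n` to the one starting at `-c - n - 1`, so it does so for even `c`.
  | .r c => c.val.bodd
  | .sr c => !c.val.bodd

theorem dihedralPerm_mul (d d' : DihedralGroup 6) :
    dihedralPerm (d * d') = dihedralPerm d * dihedralPerm d' := by
  revert d d'
  decide

theorem dihedralFlip_mul (d d' : DihedralGroup 6) :
    dihedralFlip (d * d') = xor (dihedralFlip d) (dihedralFlip d') := by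
  revert d d'
  decide

/-- The action of the dihedral group on the vertices of the hexagon. -/
def dihedralAct : DihedralGroup 6 → ZMod 6 → ZMod 6
  | .r c, n => c + n
  -- The sign of `c` agrees with the convention `r i * sr j = sr (j - i)`.
  | .sr c, n => -c - n

theorem hexagon_dihedralAct (d : DihedralGroup 6) (n : ZMod 6) :
    hexagon (dihedralAct d n)
      = dihedralPerm d * (hexagon n * if dihedralFlip d then Equiv.swap 0 1 else 1) := by
  revert d n
  decide

theorem eq_one_of_dihedralAct (d : DihedralGroup 6) (h : ∀ n, n = dihedralAct d n) : d = 1 := by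
  revert d
  decide

theorem permAct_mul_ellInv (π : Equiv.Perm (Fin 3)) :
    ellInv * permAct π = permAct π * ellInv := by
  ext1 p
  refine Subtype.ext (Amb.ext ?_ rfl)
  funext j
  rcases j with m | k <;> rfl

/-- The power of the elliptic involution. -/
def flip (e : Bool) : Equiv.Perm binomial := if e then ellInv else 1

theorem flip_xor (e e' : Bool) : flip (xor e e') = flip e * flip e' := by
  have h : ellInv * ellInv = 1 := Equiv.ext fun p => Subtype.ext (invPoint_invPoint p.1)
  cases e <;> cases e' <;> simp [flip, h]

theorem permAct_mul_flip (π : Equiv.Perm (Fin 3)) (e : Bool) :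
    flip e * permAct π = permAct π * flip e := by
  cases e <;> simp [flip, permAct_mul_ellInv]

/-- The homomorphism that realises the symmetries of the hexagon. -/
def dihedralHom : DihedralGroup 6 →* Equiv.Perm binomial :=
  MonoidHom.mk' (fun d => permAct (dihedralPerm d) * flip (dihedralFlip d)) fun d d' => by
    rw [dihedralPerm_mul, dihedralFlip_mul, map_mul, flip_xor, mul_assoc, mul_assoc,
      ← mul_assoc (flip _) (permAct _), permAct_mul_flip, mul_assoc]

theorem carries_dihedralHom (d : DihedralGroup 6) (n : ZMod 6) :
    Carries (dihedralHom d) (hexagon n) (hexagon (dihedralAct d n)) := by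
  rw [hexagon_dihedralAct]
  refine (carries_permAct _ _).mul ?_
  cases dihedralFlip d
  · simpa [flip] using carries_one (hexagon n)
  · simpa [flip] using carries_ellInv (hexagon n)

/-- If the transformation is the identity, rigidity shows that every vertex is fixed, and only the
trivial symmetry of the hexagon does that. -/
theorem dihedralHom_injective : Function.Injective dihedralHom := by
  rw [injective_iff_map_eq_one]
  intro d hd
  refine eq_one_of_dihedralAct d fun n => hexagon_bijective.1 (eq_of_carries_one ?_)
  rw [← hd]
  exact carries_dihedralHom d n

theorem range_dihedralHom : dihedralHom.range = symmetryGroup := by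
  refine le_antisymm ?_ ?_
  · rintro _ ⟨d, rfl⟩
    refine mul_mem (Subgroup.subset_closure (Or.inl ⟨_, rfl⟩)) ?_
    cases dihedralFlip d
    · exact one_mem _
    · exact Subgroup.subset_closure (Or.inr rfl)
  · refine (Subgroup.closure_le _).2 ?_
    -- The symmetries that preserve the kinds of sides already realise every permutation of the
    -- coordinates.
    have hπ : ∀ π, ∃ d, dihedralPerm d = π ∧ dihedralFlip d = false := by decide
    rintro _ (⟨π, rfl⟩ | rfl)
    · obtain ⟨d, h1, h2⟩ := hπ π
      refine ⟨d, ?_⟩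
      change permAct _ * flip _ = _
      rw [h1, h2]
      exact mul_one _
    -- The involution is the half-turn: `τ` and `τ * swap 0 1` are opposite vertices.
    · refine ⟨.r 3, ?_⟩
      change permAct _ * flip _ = _
      rw [show dihedralPerm (.r 3) = 1 by decide, map_one, one_mul]
      rfl

/-- The symmetry group of the network of flops is the dihedral group of the hexagon. -/
def dihedralEquiv : DihedralGroup 6 ≃* symmetryGroup :=
  (MonoidHom.ofInjective dihedralHom_injective).trans (MulEquiv.subgroupCongr range_dihedralHom)

theorem card_symmetryGroup : Nat.card symmetryGroup = 12 := by
  rw [← Nat.card_congr dihedralEquiv.toEquiv, DihedralGroup.nat_card]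

theorem isAutomorphism_of_mem {g : Equiv.Perm binomial} (hg : g ∈ symmetryGroup) :
    IsAutomorphism g := by
  induction hg using Subgroup.closure_induction with
  | mem g hg =>
    rcases hg with ⟨π, rfl⟩ | rfl
    · exact isAutomorphism_permAct π
    · exact isAutomorphism_ellInv
  | one => exact map_one permAct ▸ isAutomorphism_permAct 1
  | mul g g' _ _ h h' => exact h.mul h'
  | inv g _ h => exact h.inv

theorem existsUnique_carries {g : Equiv.Perm binomial} (hg : g ∈ symmetryGroup)
    (τ : Equiv.Perm (Fin 3)) : ∃! τ', Carries g τ τ' := by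
  rw [← range_dihedralHom] at hg
  obtain ⟨d, rfl⟩ := hg
  obtain ⟨n, rfl⟩ := hexagon_bijective.2 τ
  exact ⟨_, carries_dihedralHom d n, fun τ' h => h.unique (carries_dihedralHom d n)⟩

end Hexagon

/-! ### The involution as inversion on smooth elliptic fibers -/

section EllipticInverse

variable {β : Beta} {W : ℂ}

/-- At `W = 0` the fiber is `Y² + β₅XY = X³`, singular at the origin. -/
theorem ne_zero_of_Δ_ne_zero (h : (su5Curve β W).Δ ≠ 0) : W ≠ 0 := by
  rintro rfl
  refine h ?_
  simp [su5Curve, WeierstrassCurve.Δ, WeierstrassCurve.b₂, WeierstrassCurve.b₄,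
    WeierstrassCurve.b₆, WeierstrassCurve.b₈]

/-- Under `(X, Y, W) = (x²w, x²wy, xw)` the Weierstrass equation becomes `x⁴w²` times the chart
equation, and `Δ ≠ 0` makes every point of the curve nonsingular. -/
theorem nonsingular_of_mem_chartFiber (h : (su5Curve β W).Δ ≠ 0) {q : ChartPoint}
    (hq : q ∈ chartFiber β W) :
    (su5Curve β W).toAffine.Nonsingular (q.x ^ 2 * q.w) (q.x ^ 2 * q.w * q.y) := by
  rw [← WeierstrassCurve.Affine.equation_iff_nonsingular_of_Δ_ne_zero h,
    WeierstrassCurve.Affine.equation_iff]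
  obtain ⟨h1, h2⟩ := hq
  simp only [su5Curve, ← h1]
  linear_combination q.x ^ 4 * q.w ^ 2 * h2

/-- The point of the chart that represents the inverse for the group law. -/
def ChartPoint.inverse (β : Beta) (q : ChartPoint) : ChartPoint := ⟨q.x, -q.s β, q.w⟩

theorem inverse_mem_chartFiber {q : ChartPoint} (hq : q ∈ chartFiber β W) :
    q.inverse β ∈ chartFiber β W := by
  obtain ⟨h1, h2⟩ := hq
  refine ⟨h1, ?_⟩
  simp only [ChartPoint.inverse, ChartPoint.s]
  linear_combination h2

/-- Since `a₃ = β₃ x²w²`, the factor `x²w` splits off from `−Y − a₁X − a₃` and leaves `−(y + β₅ +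
wβ₃)`. -/
theorem negY_eq {q : ChartPoint} (hq : q ∈ chartFiber β W) :
    (su5Curve β W).toAffine.negY (q.x ^ 2 * q.w) (q.x ^ 2 * q.w * q.y)
      = q.x ^ 2 * q.w * -q.s β := by
  simp only [WeierstrassCurve.Affine.negY, su5Curve, ← hq.1, ChartPoint.s]
  ring

/-- On a smooth fiber `W = xw ≠ 0`, so the blow-down is injective on the chart: `X = xW` recovers
`x`, then `w = W/x`, and `Y = x²wy` recovers `y`. -/
theorem areInverse_iff (h : (su5Curve β W).Δ ≠ 0) {q q' : ChartPoint} (hq : q ∈ chartFiber β W)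
    (hq' : q' ∈ chartFiber β W) : AreInverse β W q q' ↔ q' = q.inverse β := by
  have hW := ne_zero_of_Δ_ne_zero h
  constructor
  · rintro ⟨h1, h2, h3⟩
    rw [WeierstrassCurve.Affine.Point.neg_some, WeierstrassCurve.Affine.Point.some.injEq,
      negY_eq hq] at h3
    obtain ⟨e1, e2⟩ := h3
    have hx : q'.x = q.x := by
      refine mul_right_cancel₀ hW ?_
      linear_combination e1 - q'.x * hq'.1 + q.x * hq.1
    have hx0 : q.x ≠ 0 := fun h0 => hW (by rw [← hq.1, h0, zero_mul])
    have hw0 : q.w ≠ 0 := fun h0 => hW (by rw [← hq.1, h0, mul_zero])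
    have hw : q'.w = q.w := by
      refine mul_left_cancel₀ hx0 ?_
      linear_combination hq'.1 - hq.1 - q'.w * hx
    rw [hx, hw] at e2
    exact ChartPoint.ext hx (mul_left_cancel₀ (mul_ne_zero (pow_ne_zero 2 hx0) hw0) e2) hw
  · rintro rfl
    refine ⟨nonsingular_of_mem_chartFiber h hq, nonsingular_of_mem_chartFiber h hq', ?_⟩
    rw [WeierstrassCurve.Affine.Point.neg_some, WeierstrassCurve.Affine.Point.some.injEq,
      negY_eq hq]
    exact ⟨rfl, rfl⟩

theorem toBinomial_inverse {q : ChartPoint} :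
    toBinomial β (q.inverse β) = invPoint (toBinomial β q) := by
  refine Amb.ext ?_ rfl
  funext j
  rcases j with m | k
  · fin_cases m <;> rfl
  · fin_cases k
    · rfl
    · change -q.s β + β.b5 + q.w * β.b3 = -q.y
      simp only [ChartPoint.s]
      ring

end EllipticInverse

end

end FlopNetwork

open FlopNetwork

theorem mainTheorem6 :
    -- the six varieties are small resolutions of the binomial variety, pairwise non-isomorphic
    Nat.card (Equiv.Perm (Fin 3)) = 6 ∧
    (∀ τ, IsSmallResolution 4 (res τ) binomial) ∧
    (∀ τ τ', Carries 1 τ τ' → τ = τ') ∧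
    -- flop transitions: exchange `j` with `k`, or `i` with `k`; the network is connected
    (∀ τ, FlopRel τ (τ * Equiv.swap 1 2) ∧ FlopRel τ (τ * Equiv.swap 0 2)) ∧
    (SimpleGraph.fromRel FlopRel).Connected ∧
    -- the symmetric group acts by permuting `(x, w, t)` and is transitive on the six
    (∀ π τ, Carries (permAct π) τ (π * τ)) ∧
    (∀ τ τ', ∃ π, Carries (permAct π) τ τ') ∧
    -- the involution exchanges `ℰ_{ij}` and `ℰ_{ji}` and is induced by the elliptic inverse
    (∀ τ, Carries ellInv τ (τ * Equiv.swap 0 1)) ∧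
    (∀ (β : Beta) (W : ℂ), (su5Curve β W).Δ ≠ 0 →
      ∀ (q : ChartPoint) (hq : q ∈ chartFiber β W),
        ∃ q' ∈ chartFiber β W,
          (∀ q'' ∈ chartFiber β W, AreInverse β W q q'' ↔ q'' = q') ∧
          toBinomial β q' = (ellInv ⟨toBinomial β q, toBinomial_mem hq⟩).1) ∧
    -- the group they generate acts by automorphisms, permutes the six, and has order `12`
    (∀ g ∈ symmetryGroup,
      (∃ φ, IsRegularIso φ binomial binomial ∧ ∀ b : binomial, φ b.1 = (g b).1) ∧
      ∀ τ, ∃! τ', Carries g τ τ') ∧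
    Nat.card symmetryGroup = 12 ∧
    -- it is the dihedral group of a hexagon of flop transitions through the six resolutions
    (∃ (h : ZMod 6 ≃ Equiv.Perm (Fin 3)) (Ψ : symmetryGroup ≃* DihedralGroup 6),
      (∀ n, FlopRel (h n) (h (n + 1))) ∧
      (∀ c n, Carries (Ψ.symm (DihedralGroup.r c)).1 (h n) (h (c + n))) ∧
      (∀ c n, Carries (Ψ.symm (DihedralGroup.sr c)).1 (h n) (h (-c - n)))) := by
  refine ⟨?_, isSmallResolution_res, fun τ τ' h => eq_of_carries_one h,
    fun τ => ⟨flopRel_mul_swap_one_two τ, flopRel_mul_swap_zero_two τ⟩, connected_flopRel,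
    carries_permAct, fun τ τ' => ⟨τ' * τ⁻¹, ?_⟩, carries_ellInv, ?_,
    fun g hg => ⟨isAutomorphism_of_mem hg, existsUnique_carries hg⟩, card_symmetryGroup,
    hexagonEquiv, dihedralEquiv.symm, flopRel_hexagon, fun c => carries_dihedralHom (.r c),
    fun c => carries_dihedralHom (.sr c)⟩
  · rw [Nat.card_eq_fintype_card, Fintype.card_perm]
    rfl
  · have h := carries_permAct (τ' * τ⁻¹) τ
    rwa [inv_mul_cancel_right] at h
  · intro β W h q hq
    exact ⟨q.inverse β, inverse_mem_chartFiber hq,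
      fun q'' hq'' => areInverse_iff h hq hq'', toBinomial_inverse⟩
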